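/- **Conventions.** An extended pseudometric space is a set with a symmetric distance $d$ with values in $[0,\infty]$, $d(x,x)=0$, satisfying the triangle inequality; morphisms are $1$-Lipschitz maps. Let $\mathsf{Met}$ be the category of (small) metric spaces and $\mathsf{tbMet}\subset\mathsf{Met}$ that of totally bounded ones. Fibre products carry the maximum distance. Write $*$ for the one-point space and $2_r=\{0,r\}\subset\mathbb R$. A *submetry* is a surjective $1$-Lipschitz map $f:X\to B$ such that $d^{\mathrm H}_X(f^{-1}(b_0),f^{-1}(b_1))\le d_B(b_0,b_1)<\infty$ for all $b_0,b_1\in B$, where $d^{\mathrm H}$ is the Hausdorff distance. It is *proper* if it is closed with compact fibres. A $1$-Lipschitz map $f:X\to Y$ of metric spaces is a *local submetry* if each $x\in X$ has an $r>0$ such that $f(B(x',s))=B(f(x'),s)$ whenever $d(x,x')<r$ and $0<s<r-d(x,x')$. An *lsm covering* of $X\in\mathsf{tbMet}$ is a family of local submetries $f_i:U_i\to X$ in $\mathsf{tbMet}$ such that for all $x_1,x_2,x_3\in X$ and $\varepsilon>0$ there are an $i$ and $u_k\in f_i^{-1}(x_k)$ with $d(u_1,u_2)<d(x_1,x_2)+\varepsilon$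 and $d(u_2,u_3)<d(x_2,x_3)+\varepsilon$. These coverings define the *lsm topology* on $\mathsf{tbMet}$ (a sieve is covering if it contains an lsm covering); stacks are stacks in groupoids for it. An extended pseudometric space $N$ is regarded as the stack $T\mapsto\mathrm{Hom}(T,N)$. For a stack $\mathcal X$, let $\pi_0(\mathcal X)$ be the sheafification of the presheaf $T\mapsto\{\text{isomorphism classes of }\mathcal X(T)\}$, let $\mu$ be the left Kan extension, along the Yoneda embedding, of the inclusion of $\mathsf{tbMet}$ into extended pseudometric spaces, and put $\mu(\mathcal X)=\mu(\pi_0(\mathcal X))$. The natural morphism $\pi_{\mathcal X}:\mathcal X\to\mu(\mathcal X)$ is the *good moduli space* of $\mathcal X$: it is universal among morphisms from $\mathcal X$ to extended pseudometric spaces. It is a *coarse moduli space* if $\mu(\mathcal X)\in\mathsf{Met}$. A morphism of stacks $f:\mathcal X\to\mathcal Y$ is a *formal submetry* if $\mathcal X(*)\to\mathcal Y(*)$ is essentially surjective and, for all real $r>s>0$, all $x\in\mathcal X(*)$ and $g\in\mathcal Y(2_s)$ and every isomorphism $\alpha:f(x)\cong g|_0$, there are $h\in\mathcal X(2_r)$,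 an isomorphism $h|_0\cong x$, and an isomorphism between $f(h)$ and the pullback of $g$ along the bijection $2_r\to 2_s$ fixing $0$, compatible with $\alpha$ over $0$. A stack $\mathcal X$ is a *naive metric stack* if it admits a formal submetry from a metric space, and such an $\mathcal X$ is *separated* if there is a formal submetry $p:X\to\mathcal X$ from a metric space $X$ such that for every $x\in\mathcal X(*)$ the set $\{x'\in X: p(x')\cong x\}$ is closed in $X$. The *Gromov–Hausdorff stack* $\mathcal{GH}$ is the category fibred in groupoids over $\mathsf{tbMet}$ whose objects over $T$ are the proper submetries $P\to T$ with $P\in\mathsf{Met}$, and whose morphisms are the cartesian squares. **Statement.** $\mathcal{GH}$ is a naive metric stack and it is separated. In particular, $\pi_{\mathcal{GH}}:\mathcal{GH}\to\mu(\mathcal{GH})$ is a coarse moduli space: it is a good moduli space and $\mu(\mathcal{GH})$ is a metric space. Moreover, $\mu(\mathcal{GH})$ is complete. -/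

import Mathlib

open CategoryTheory CategoryTheory.Functor Opposite
open scoped ENNReal

universe w v u

namespace GHStack

/-! ## Metric spaces and 1-Lipschitz maps -/

/-- A morphism of (extended pseudo)metric spaces: a map that does not increase distances. -/
@[ext]
structure LipMap (X : Type*) (Y : Type*) [PseudoEMetricSpace X] [PseudoEMetricSpace Y] where
  toFun : X → Y
  edist_le : ∀ x y, edist (toFun x) (toFun y) ≤ edist x y

namespace LipMap

instance {X Y : Type*} [PseudoEMetricSpace X] [PseudoEMetricSpace Y] :
    CoeFun (LipMap X Y) (fun _ => X → Y) := ⟨LipMap.toFun⟩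

/-- The identity morphism. -/
def id (X : Type*) [PseudoEMetricSpace X] : LipMap X X := ⟨fun x => x, fun _ _ => le_rfl⟩

/-- The composite `g ∘ f`. -/
def comp {X Y Z : Type*} [PseudoEMetricSpace X] [PseudoEMetricSpace Y] [PseudoEMetricSpace Z]
    (g : LipMap Y Z) (f : LipMap X Y) : LipMap X Z :=
  ⟨fun x => g (f x), fun x y => (g.edist_le _ _).trans (f.edist_le x y)⟩

theorem continuous {X Y : Type*} [PseudoEMetricSpace X] [PseudoEMetricSpace Y]
    (f : LipMap X Y) : Continuous f.toFun :=
  LipschitzWith.continuous (K := 1) fun x y => by simpa using f.edist_le x y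

theorem dist_le {X Y : Type*} [PseudoMetricSpace X] [PseudoMetricSpace Y]
    (f : LipMap X Y) (x y : X) : dist (f x) (f y) ≤ dist x y :=
  (LipschitzWith.of_edist_le f.edist_le).dist_le_mul x y |>.trans (by simp)

/-- A map between metric spaces that does not increase real distances. -/
def ofDist {X Y : Type*} [PseudoMetricSpace X] [PseudoMetricSpace Y]
    (f : X → Y) (h : ∀ x y, dist (f x) (f y) ≤ dist x y) : LipMap X Y :=
  ⟨f, fun x y => by rw [edist_dist, edist_dist]; exact ENNReal.ofReal_le_ofReal (h x y)⟩

end LipMap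

/-- An extended pseudometric space (with underlying set in `Type w`). -/
structure EPMet where
  carrier : Type w
  [str : PseudoEMetricSpace carrier]

namespace EPMet

instance : CoeSort EPMet.{w} (Type w) := ⟨EPMet.carrier⟩

instance (X : EPMet.{w}) : PseudoEMetricSpace X := X.str

/-- The category of extended pseudometric spaces and 1-Lipschitz maps. -/
instance : Category EPMet.{w} where
  Hom X Y := LipMap X Y
  id X := LipMap.id X
  comp f g := LipMap.comp g f

theorem hom_ext {X Y : EPMet.{w}} {f g : X ⟶ Y} (h : ∀ x : X, LipMap.toFun f x = LipMap.toFun g x) :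
    f = g :=
  LipMap.ext (funext h)

section Colimits

variable {J : Type w} [Category.{v} J] (F : J ⥤ EPMet.{w})

/-- The set of points of a colimit. -/
def ColimPt : Type w :=
  Quot (α := Σ j, (F.obj j : Type w))
    (fun x y => ∃ f : x.1 ⟶ y.1, LipMap.toFun (F.map f) x.2 = y.2)

/-- The structure map from the `j`-th space to the colimit. -/
def colimMk (j : J) (x : F.obj j) : ColimPt F := Quot.mk _ ⟨j, x⟩

/-- The extended pseudodistances for which all structure maps are 1-Lipschitz. -/
structure Admissible (e : ColimPt F → ColimPt F → ℝ≥0∞) : Prop where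
  self : ∀ x, e x x = 0
  comm : ∀ x y, e x y = e y x
  triangle : ∀ x y z, e x z ≤ e x y + e y z
  le : ∀ (j : J) (x y : F.obj j), e (colimMk F j x) (colimMk F j y) ≤ edist x y

/-- The distance on the colimit is the largest admissible one. -/
noncomputable instance : PseudoEMetricSpace (ColimPt F) where
  edist x y := ⨆ e : {e // Admissible F e}, e.1 x y
  edist_self x := by simp [fun e : {e // Admissible F e} => e.2.self x]
  edist_comm x y := iSup_congr fun e => e.2.comm x y
  edist_triangle x y z := iSup_le fun e => (e.2.triangle x y z).trans
    (add_le_add (le_iSup (fun e : {e // Admissible F e} => e.1 x y) e)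
      (le_iSup (fun e : {e // Admissible F e} => e.1 y z) e))

/-- The colimit cocone. -/
noncomputable def colimCocone : Limits.Cocone F where
  pt := ⟨ColimPt F⟩
  ι :=
    { app j := (⟨colimMk F j, fun x y => iSup_le fun e => e.2.le j x y⟩ : LipMap _ _)
      naturality _ _ f := hom_ext fun _ => (Quot.sound ⟨f, rfl⟩ :
        Quot.mk _ _ = Quot.mk _ _).symm }

/-- The map out of the colimit induced by a cocone. -/
def colimDesc (s : Limits.Cocone F) : ColimPt F → s.pt :=
  Quot.lift (fun x => LipMap.toFun (s.ι.app x.1) x.2) (by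
    rintro ⟨j, x⟩ ⟨k, y⟩ ⟨f, hf⟩
    dsimp at f hf ⊢
    rw [← hf]
    exact (congrArg (fun g => LipMap.toFun g x) (s.w f)).symm)

/-- The colimit cocone is a colimit. -/
noncomputable def colimIsColimit : Limits.IsColimit (colimCocone F) where
  desc s := (⟨colimDesc F s, fun x y =>
    le_iSup (fun e : {e // Admissible F e} => e.1 x y)
      ⟨fun x y => edist (colimDesc F s x) (colimDesc F s y),
        { self := fun _ => edist_self _
          comm := fun _ _ => edist_comm _ _
          triangle := fun _ _ _ => edist_triangle _ _ _
          le := fun j x y => LipMap.edist_le (s.ι.app j) x y }⟩⟩ : LipMap _ _)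
  fac s j := rfl
  uniq s m hm := hom_ext fun x => by
    obtain ⟨j, x⟩ := x
    exact congrArg (fun g => LipMap.toFun g x) (hm j)

end Colimits

instance : Limits.HasColimitsOfSize.{v, w} EPMet.{w} where
  has_colimits_of_shape _ _ :=
    { has_colimit := fun F => ⟨⟨⟨colimCocone F, colimIsColimit F⟩⟩⟩ }

/-- `X` is a metric space in the universe `u` (up to relabelling of its points): distinct points
have positive distance, all distances are finite, and its set of points is `u`-small. -/
structure IsMet (X : EPMet.{w}) : Prop where
  small : Small.{u} X
  edist_ne_top : ∀ x y : X, edist x y ≠ ⊤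
  eq_of_edist : ∀ x y : X, edist x y = 0 → x = y

end EPMet

/-- A totally bounded metric space. -/
structure TBMet where
  carrier : Type u
  [str : MetricSpace carrier]
  totallyBounded : TotallyBounded (Set.univ : Set carrier)

namespace TBMet

instance : CoeSort TBMet.{u} (Type u) := ⟨TBMet.carrier⟩

instance (X : TBMet.{u}) : MetricSpace X := X.str

/-- The category of totally bounded metric spaces and 1-Lipschitz maps. -/
instance : Category TBMet.{u} where
  Hom X Y := LipMap X Y
  id X := LipMap.id X
  comp f g := LipMap.comp g f

theorem hom_ext {X Y : TBMet.{u}} {f g : X ⟶ Y} (h : ∀ x : X, LipMap.toFun f x = LipMap.toFun g x) :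
    f = g :=
  LipMap.ext (funext h)

/-- The inclusion of totally bounded metric spaces into extended pseudometric spaces. The universe
of the latter is raised by one because the isomorphism classes of objects of a fibre category live
there. -/
def incl : TBMet.{u} ⥤ EPMet.{u + 1} where
  obj X := ⟨ULift.{u + 1} X⟩
  map f := (⟨fun x => ULift.up (LipMap.toFun f x.down),
    fun x y => LipMap.edist_le f x.down y.down⟩ : LipMap _ _)

/-- The one-point space. -/
def pt : TBMet.{u} := ⟨PUnit.{u + 1}, Set.finite_univ.totallyBounded⟩

/-- The point `x` of `X` as a morphism from the one-point space. -/
def ptMap {X : Type*} [PseudoEMetricSpace X] (x : X) : LipMap pt.{u} X :=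
  ⟨fun _ => x, fun _ _ => by simp⟩

/-- The subspace `{0, r}` of the real line. -/
def two (r : ℝ) : TBMet.{u} :=
  ⟨ULift.{u} ({0, r} : Set ℝ), Set.finite_univ.totallyBounded⟩

/-- The morphism `* ⟶ {0, r}` with value `0`. -/
def zero (r : ℝ) : pt.{u} ⟶ two.{u} r := ptMap ⟨0, by simp⟩

/-- For `0 < s < r`, the bijection `{0, r} ⟶ {0, s}` that sends `0` to `0` and `r` to `s`. -/
noncomputable def shrink {r s : ℝ} (hs : 0 < s) (hr : s < r) : two.{u} r ⟶ two.{u} s :=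
  LipMap.ofDist (fun x => ⟨s / r * x.down.1, by
      obtain ⟨⟨x, rfl | rfl⟩⟩ := x
      · simp
      · simp [div_mul_cancel₀ s (hs.trans hr).ne']⟩) (by
    rintro ⟨x, hx⟩ ⟨y, hy⟩
    change |s / r * x - s / r * y| ≤ |x - y|
    rw [← mul_sub, abs_mul, abs_of_pos (div_pos hs (hs.trans hr))]
    exact mul_le_of_le_one_left (abs_nonneg _) ((div_le_one (hs.trans hr)).2 hr.le))

/-- The fibre product `X ×_Z Y`, with the maximum distance. -/
abbrev FibProd {X Y Z : Type*} (f : X → Z) (g : Y → Z) : Type _ := {q : X × Y // f q.1 = g q.2}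

end TBMet

/-! ## Submetries, local submetries and the lsm topology -/

/-- `f` is a submetry: it is surjective, and for all points `b₀`, `b₁` of the target the Hausdorff
distance between their fibres is at most their distance, which is finite. -/
def IsSubmetry {X B : Type*} [PseudoEMetricSpace X] [PseudoEMetricSpace B] (f : LipMap X B) :
    Prop :=
  Function.Surjective f.toFun ∧ ∀ b₀ b₁ : B,
    Metric.hausdorffEDist (f.toFun ⁻¹' {b₀}) (f.toFun ⁻¹' {b₁}) ≤ edist b₀ b₁ ∧ edist b₀ b₁ < ⊤

/-- `f` is a local submetry: every point has a radius `r > 0` such that `f` maps balls contained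
in the `r`-ball (in the sense of `d(x, x') + s < r`) onto balls of the same radius. -/
def IsLocalSubmetry {X Y : Type*} [MetricSpace X] [MetricSpace Y] (f : LipMap X Y) : Prop :=
  ∀ x, ∃ r > 0, ∀ x' ∈ Metric.ball x r, ∀ s, 0 < s → s < r - dist x x' →
    f.toFun '' Metric.ball x' s = Metric.ball (f x') s

theorem IsLocalSubmetry.id (X : Type*) [MetricSpace X] : IsLocalSubmetry (LipMap.id X) :=
  fun _ => ⟨1, one_pos, fun _ _ _ _ _ => Set.image_id _⟩

theorem IsLocalSubmetry.comp {X Y Z : Type*} [MetricSpace X] [MetricSpace Y] [MetricSpace Z]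
    {g : LipMap Y Z} {f : LipMap X Y} (hg : IsLocalSubmetry g) (hf : IsLocalSubmetry f) :
    IsLocalSubmetry (g.comp f) := by
  intro x
  obtain ⟨r, hr, h⟩ := hf x
  obtain ⟨r', hr', h'⟩ := hg (f x)
  refine ⟨min r r', lt_min hr hr', fun x' hx' s hs hsr => ?_⟩
  have hd : dist x x' < min r r' := by rw [dist_comm]; exact hx'
  have h1 := h x' (by rw [Metric.mem_ball, dist_comm]; exact hd.trans_le (min_le_left _ _)) s hs
    (hsr.trans_le (sub_le_sub_right (min_le_left _ _) _))
  have hfd := f.dist_le x x'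
  have h2 := h' (f x') (by
    rw [Metric.mem_ball, dist_comm]
    exact hfd.trans_lt (hd.trans_le (min_le_right _ _))) s hs (by
    have := min_le_right r r'
    linarith)
  change (fun y => g (f y)) '' _ = Metric.ball (g (f x')) s
  rw [← h2, ← h1, Set.image_image]

/-- The projection of a fibre product to the second factor. -/
def projSnd {X Y Z : Type*} [PseudoEMetricSpace X] [PseudoEMetricSpace Y] (f : X → Z) (g : Y → Z) :
    LipMap (TBMet.FibProd f g) Y :=
  ⟨fun q => q.1.2, fun x y => by
    rw [Subtype.edist_eq, Prod.edist_eq]; exact le_max_right _ _⟩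

/-- The projection of a fibre product to the first factor. -/
def projFst {X Y Z : Type*} [PseudoEMetricSpace X] [PseudoEMetricSpace Y] (f : X → Z) (g : Y → Z) :
    LipMap (TBMet.FibProd f g) X :=
  ⟨fun q => q.1.1, fun x y => by
    rw [Subtype.edist_eq, Prod.edist_eq]; exact le_max_left _ _⟩

theorem IsLocalSubmetry.projSnd {X Y Z : Type*} [MetricSpace X] [MetricSpace Y] [MetricSpace Z]
    {f : LipMap X Z} (hf : IsLocalSubmetry f) (g : LipMap Y Z) :
    IsLocalSubmetry (projSnd f.toFun g.toFun) := by
  rintro ⟨⟨x, y⟩, hxy⟩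
  obtain ⟨r, hr, h⟩ := hf x
  refine ⟨r, hr, ?_⟩
  rintro ⟨⟨x', y'⟩, hxy'⟩ hx' s hs hsr
  have hd : dist x x' ≤ dist (⟨(x, y), hxy⟩ : TBMet.FibProd f.toFun g.toFun) ⟨(x', y'), hxy'⟩ :=
    (projFst f.toFun g.toFun).dist_le ⟨(x, y), hxy⟩ ⟨(x', y'), hxy'⟩
  have hb : dist x x' < r := by
    rw [Metric.mem_ball, dist_comm] at hx'
    exact hd.trans_lt hx'
  have h1 := h x' (by rw [Metric.mem_ball, dist_comm]; exact hb) s hs (by linarith)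
  ext t
  constructor
  · rintro ⟨q, hq, rfl⟩
    exact ((GHStack.projSnd f.toFun g.toFun).dist_le _ _).trans_lt hq
  · intro ht
    have hgt : g t ∈ Metric.ball (f x') s := by
      change dist (g t) (f x') < s
      rw [show f x' = g y' from hxy']
      exact (g.dist_le _ _).trans_lt ht
    rw [← h1] at hgt
    obtain ⟨z, hz, hzt⟩ := hgt
    refine ⟨⟨(z, t), hzt⟩, ?_, rfl⟩
    exact (max_lt hz ht : max (dist z x') (dist t y') < s)

/-- The fibre product in the category of totally bounded metric spaces. -/
def TBMet.fibProd {X Y Z : TBMet.{u}} (f : X ⟶ Z) (g : Y ⟶ Z) : TBMet.{u} :=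
  ⟨TBMet.FibProd (LipMap.toFun f) (LipMap.toFun g), by
    have h : TotallyBounded (Set.univ : Set (X × Y)) := by
      refine Metric.totallyBounded_iff.2 fun ε hε => ?_
      obtain ⟨a, ha, hXa⟩ := Metric.totallyBounded_iff.1 X.totallyBounded ε hε
      obtain ⟨b, hb, hYb⟩ := Metric.totallyBounded_iff.1 Y.totallyBounded ε hε
      refine ⟨a ×ˢ b, ha.prod hb, fun q _ => ?_⟩
      obtain ⟨x, hx, hqx⟩ := Set.mem_iUnion₂.1 (hXa (Set.mem_univ q.1))
      obtain ⟨y, hy, hqy⟩ := Set.mem_iUnion₂.1 (hYb (Set.mem_univ q.2))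
      refine Set.mem_iUnion₂.2 ⟨(x, y), ⟨hx, hy⟩, ?_⟩
      exact (max_lt hqx hqy : max (dist q.1 x) (dist q.2 y) < ε)
    exact totallyBounded_preimage isUniformEmbedding_subtype_val.isUniformInducing h⟩

/-- A family of morphisms with target `X` (given as a set of arrows) is an lsm covering: its members
are local submetries, and any three points `x₁, x₂, x₃` of `X` and `ε > 0` admit lifts to some
member that increase `d(x₁, x₂)` and `d(x₂, x₃)` by less than `ε`. -/
structure IsLsmCovering {X : TBMet.{u}} (R : Presieve X) : Prop where
  local_submetry : ∀ ⦃U : TBMet.{u}⦄ (f : U ⟶ X), R f → IsLocalSubmetry f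
  lift : ∀ (x₁ x₂ x₃ : X) (ε : ℝ), 0 < ε → ∃ (U : TBMet.{u}) (f : U ⟶ X), R f ∧
    ∃ u₁ u₂ u₃ : U, LipMap.toFun f u₁ = x₁ ∧ LipMap.toFun f u₂ = x₂ ∧ LipMap.toFun f u₃ = x₃ ∧
      dist u₁ u₂ < dist x₁ x₂ + ε ∧ dist u₂ u₃ < dist x₂ x₃ + ε

/-- The lsm topology: a sieve is covering if and only if it contains an lsm covering. -/
def lsm : GrothendieckTopology TBMet.{u} where
  sieves X := {S | ∃ R : Presieve X, IsLsmCovering R ∧ R ≤ S.arrows}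
  top_mem' X := by
    refine ⟨Presieve.singleton (𝟙 X), ⟨?_, ?_⟩, fun _ _ _ => trivial⟩
    · rintro U f ⟨⟩
      exact IsLocalSubmetry.id X
    · intro x₁ x₂ x₃ ε hε
      exact ⟨X, 𝟙 X, ⟨⟩, x₁, x₂, x₃, rfl, rfl, rfl, lt_add_of_pos_right _ hε,
        lt_add_of_pos_right _ hε⟩
  pullback_stable' := by
    rintro X Y S g ⟨R, hR, hRS⟩
    refine ⟨fun V h => ∃ (U : TBMet.{u}) (f : U ⟶ X) (_ : R f) (e : V = TBMet.fibProd f g),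
      h = eqToHom e ≫ projSnd (LipMap.toFun f) (LipMap.toFun g), ⟨?_, ?_⟩, ?_⟩
    · rintro V h ⟨U, f, hf, rfl, rfl⟩
      exact (hR.local_submetry f hf).projSnd g
    · intro y₁ y₂ y₃ ε hε
      obtain ⟨U, f, hf, u₁, u₂, u₃, h₁, h₂, h₃, h₁₂, h₂₃⟩ :=
        hR.lift (LipMap.toFun g y₁) (LipMap.toFun g y₂) (LipMap.toFun g y₃) ε hε
      have hg := LipMap.dist_le (X := Y) (Y := X) g
      exact ⟨TBMet.fibProd f g, _, ⟨U, f, hf, rfl, rfl⟩, ⟨(u₁, y₁), h₁⟩, ⟨(u₂, y₂), h₂⟩,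
        ⟨(u₃, y₃), h₃⟩, rfl, rfl, rfl,
        max_lt (h₁₂.trans_le (add_le_add_left (hg _ _) _)) (lt_add_of_pos_right _ hε),
        max_lt (h₂₃.trans_le (add_le_add_left (hg _ _) _)) (lt_add_of_pos_right _ hε)⟩
    · rintro V h ⟨U, f, hf, rfl, rfl⟩
      have : (eqToHom rfl ≫ projSnd (LipMap.toFun f) (LipMap.toFun g) :
          TBMet.fibProd f g ⟶ Y) ≫ g = (projFst (LipMap.toFun f) (LipMap.toFun g) :
          TBMet.fibProd f g ⟶ U) ≫ f :=
        TBMet.hom_ext fun q => (q.2 : LipMap.toFun f q.1.1 = LipMap.toFun g q.1.2).symm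
      change S.arrows (_ ≫ g)
      rw [this]
      exact S.downward_closed (hRS _ _ hf) _
  transitive' := by
    rintro X S ⟨R, hR, hRS⟩ T hT
    choose! R' hR' hR'T using fun (Y : TBMet.{u}) (f : Y ⟶ X) (hf : S f) => hT hf
    refine ⟨fun V h => ∃ (U : TBMet.{u}) (f : U ⟶ X) (_ : R f) (k : V ⟶ U) (_ : R' U f k),
      h = k ≫ f, ⟨?_, ?_⟩, ?_⟩
    · rintro V h ⟨U, f, hf, k, hk, rfl⟩
      exact (hR.local_submetry f hf).comp ((hR' U f (hRS _ _ hf)).local_submetry k hk)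
    · intro x₁ x₂ x₃ ε hε
      obtain ⟨U, f, hf, u₁, u₂, u₃, rfl, rfl, rfl, h₁₂, h₂₃⟩ := hR.lift x₁ x₂ x₃ (ε / 2) (by positivity)
      obtain ⟨V, k, hk, v₁, v₂, v₃, rfl, rfl, rfl, k₁₂, k₂₃⟩ :=
        (hR' U f (hRS _ _ hf)).lift u₁ u₂ u₃ (ε / 2) (by positivity)
      exact ⟨V, k ≫ f, ⟨U, f, hf, k, hk, rfl⟩, v₁, v₂, v₃, rfl, rfl, rfl, by linarith, by linarith⟩
    · rintro V h ⟨U, f, hf, k, hk, rfl⟩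
      exact hR'T U f (hRS _ _ hf) _ _ hk

/-! ## Stacks in groupoids over the lsm site -/

/-- A functor is fibred in groupoids if it is a fibred category all of whose fibre categories are
groupoids. -/
class IsFiberedInGroupoids {𝒮 : Type*} [Category 𝒮] {𝒳 : Type*} [Category 𝒳] (p : 𝒳 ⥤ 𝒮) : Prop
    extends p.IsFibered where
  isIso {S : 𝒮} {a b : Fiber p S} (φ : a ⟶ b) : IsIso φ

/-- A sieve, as a category fibred over the base. -/
def sieveCat {U : TBMet.{u}} (S : Sieve U) : BasedCategory.{u, u + 1} TBMet.{u} :=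
  BasedCategory.ofFunctor (𝒳 := S.arrows.category) (ObjectProperty.ι _ ⋙ Over.forget U)

/-- Stacks in groupoids for the lsm topology: categories fibred in groupoids such that isomorphisms
of objects over the same base glue uniquely along covering sieves, and such that every descent datum
along a covering sieve is effective. A descent datum along `S` is a morphism of fibred categories
from `S`; it is effective if it is the restriction of an object `x`, i.e. if there are arrows to `x`
lying over the members of `S` and compatible with the datum (all arrows of a category fibred in
groupoids are cartesian). Similarly, a family of isomorphisms on the restrictions of `x` is recorded
by its values on all arrows `α` into `x` that lie over members of the sieve. -/
structure IsStackInGroupoids (𝒳 : BasedCategory.{v, w} TBMet.{u}) : Prop where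
  fibered : IsFiberedInGroupoids 𝒳.p
  glue_hom : ∀ (x y : 𝒳.obj), 𝒳.p.obj y = 𝒳.p.obj x → ∀ S ∈ lsm.{u} (𝒳.p.obj x),
    ∀ φ : ∀ (c : 𝒳.obj) (α : c ⟶ x), S (𝒳.p.map α) → (c ⟶ y),
      (∀ c α h, 𝒳.p.IsHomLift (𝒳.p.map α) (φ c α h)) →
      (∀ (c c' : 𝒳.obj) (γ : c' ⟶ c) (α : c ⟶ x) (h : S (𝒳.p.map α))
        (h' : S (𝒳.p.map (γ ≫ α))), φ c' (γ ≫ α) h' = γ ≫ φ c α h) →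
      ∃! ψ : x ⟶ y, 𝒳.p.IsHomLift (𝟙 (𝒳.p.obj x)) ψ ∧ ∀ c α h, α ≫ ψ = φ c α h
  effective : ∀ (U : TBMet.{u}) (S : Sieve U), S ∈ lsm.{u} U → ∀ D : BasedFunctor (sieveCat S) 𝒳,
    ∃ (x : 𝒳.obj) (_ : 𝒳.p.obj x = U) (c : ∀ t : S.arrows.category, D.obj t ⟶ x),
      (∀ t, 𝒳.p.IsHomLift t.obj.hom (c t)) ∧
      ∀ (t t' : S.arrows.category) (k : t ⟶ t'), D.map k ≫ c t' = c t

/-- The functor induced on fibre categories by a morphism of categories over the base. -/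
def fiberFunctor {𝒮 : Type*} [Category 𝒮] {𝒳 : BasedCategory.{v, w} 𝒮}
    {𝒴 : BasedCategory 𝒮} (F : BasedFunctor 𝒳 𝒴) (S : 𝒮) : Fiber 𝒳.p S ⥤ Fiber 𝒴.p S where
  obj x := ⟨F.obj x.1, (F.w_obj x.1).trans x.2⟩
  map φ := ⟨F.map φ.1, haveI := φ.2; F.preserves_isHomLift (𝟙 S) φ.1⟩
  map_id x := Subtype.ext (F.map_id x.1)
  map_comp φ ψ := Subtype.ext (F.map_comp φ.1 ψ.1)

/-! ### Spaces as stacks -/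

/-- A morphism from a totally bounded metric space to `N`. -/
structure ElObj (N : Type w) [PseudoEMetricSpace N] where
  base : TBMet.{u}
  map : LipMap base N

instance (N : Type w) [PseudoEMetricSpace N] : Category (ElObj.{w, u} N) where
  Hom a b := {f : a.base ⟶ b.base // b.map.comp f = a.map}
  id a := ⟨𝟙 a.base, rfl⟩
  comp f g := ⟨f.1 ≫ g.1, (congrArg (fun k => LipMap.comp k f.1) g.2).trans f.2⟩

/-- The extended pseudometric space `N`, regarded as a stack: the category of totally bounded metric
spaces over `N`, i.e. the Grothendieck construction of the presheaf `Hom(-, N)`. -/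
def El (N : Type w) [PseudoEMetricSpace N] : BasedCategory TBMet.{u} :=
  BasedCategory.ofFunctor (𝒳 := ElObj.{w, u} N)
    { obj := fun a => a.base
      map := fun f => f.1 }

/-- The morphism of stacks induced by a morphism of spaces. -/
def El.map {M N : Type w} [PseudoEMetricSpace M] [PseudoEMetricSpace N] (f : LipMap M N) :
    BasedFunctor (El.{w, u} M) (El.{w, u} N) where
  obj a := ⟨a.base, f.comp a.map⟩
  map {a b} k := ⟨k.1, congrArg f.comp k.2⟩
  w := rfl

/-- A point of `N`, as an object over the one-point space. -/
def El.point {N : Type w} [PseudoEMetricSpace N] (x : N) : Fiber (El.{w, u} N).p TBMet.pt :=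
  ⟨⟨TBMet.pt, TBMet.ptMap x⟩, rfl⟩

/-! ### Formal submetries, naive metric stacks and separatedness -/

/-- Formal submetries of stacks in groupoids. An object `g` over `{0, s}` together with an
isomorphism of `F x` with its restriction along `0` is the same as an arrow `α : F x ⟶ g` over
`* ⟶ {0, s}`; similarly for `β` and `γ`. -/
structure IsFormalSubmetry {𝒳 : BasedCategory.{v, w} TBMet.{u}} {𝒴 : BasedCategory TBMet.{u}}
    (F : BasedFunctor 𝒳 𝒴) : Prop where
  essSurj : (fiberFunctor F TBMet.pt).EssSurj
  lift : ∀ (r s : ℝ) (hs : 0 < s) (hr : s < r) (x : 𝒳.obj) (g : 𝒴.obj) (α : F.obj x ⟶ g),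
    𝒴.p.IsHomLift (TBMet.zero s) α →
    ∃ (h : 𝒳.obj) (β : x ⟶ h) (γ : F.obj h ⟶ g), 𝒳.p.IsHomLift (TBMet.zero r) β ∧
      𝒴.p.IsHomLift (TBMet.shrink hs hr) γ ∧ F.map β ≫ γ = α

/-- A naive metric stack is a stack in groupoids that admits a formal submetry from a metric
space. -/
def IsNaiveMetricStack (𝒳 : BasedCategory.{v, w} TBMet.{u}) : Prop :=
  IsStackInGroupoids 𝒳 ∧ ∃ (X : Type u) (_ : MetricSpace X) (F : BasedFunctor (El.{u, u} X) 𝒳),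
    IsFormalSubmetry F

/-- A naive metric stack is separated if it admits a formal submetry from a metric space `X` such
that for every object `x` over the one-point space the points of `X` with image isomorphic to `x`
form a closed set. -/
def IsSeparated (𝒳 : BasedCategory.{v, w} TBMet.{u}) : Prop :=
  IsNaiveMetricStack 𝒳 ∧
    ∃ (X : Type u) (_ : MetricSpace X) (F : BasedFunctor (El.{u, u} X) 𝒳),
      IsFormalSubmetry F ∧ ∀ x : Fiber 𝒳.p TBMet.pt,
        IsClosed {x' : X | Nonempty ((fiberFunctor F TBMet.pt).obj (El.point x') ≅ x)}

/-! ### Good and coarse moduli spaces -/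

section Moduli

theorem nonempty_fiber_iso {𝒮 : Type*} [Category 𝒮] {𝒳 : Type*} [Category 𝒳] {p : 𝒳 ⥤ 𝒮}
    [p.IsFibered] {R S : 𝒮} (f : R ⟶ S) {a b : Fiber p S} (e : a ≅ b) {c d : Fiber p R}
    (φ : c.1 ⟶ a.1) (ψ : d.1 ⟶ b.1) [p.IsCartesian f φ] [p.IsCartesian f ψ] :
    Nonempty (c ≅ d) := by
  have h1 := e.hom.2
  let e' : a.1 ≅ b.1 := Fiber.fiberInclusion.mapIso e
  have : p.IsHomLift (𝟙 S) e'.hom := e.hom.2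
  have : p.IsCartesian f (φ ≫ e'.hom) := inferInstance
  let i := IsCartesian.domainUniqueUpToIso p f ψ (φ ≫ e'.hom)
  exact ⟨⟨⟨i.hom, inferInstance⟩, ⟨i.inv, inferInstance⟩, Subtype.ext i.hom_inv_id,
    Subtype.ext i.inv_hom_id⟩⟩

variable (𝒳 : BasedCategory.{u, u + 1} TBMet.{u})

open Functor.IsPreFibered in
/-- The presheaf of isomorphism classes of objects of the fibre categories. -/
noncomputable def isoClasses [𝒳.p.IsFibered] : TBMet.{u}ᵒᵖ ⥤ Type (u + 1) where
  obj U := Quotient (isIsomorphicSetoid (Fiber 𝒳.p U.unop))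
  map f := TypeCat.ofHom (Quotient.map
    (fun x => ⟨pullbackObj x.2 f.unop, pullbackObj_proj x.2 f.unop⟩)
    (fun x y ⟨e⟩ => nonempty_fiber_iso f.unop e (pullbackMap x.2 f.unop) (pullbackMap y.2 f.unop)))
  map_id U := by
    ext x
    obtain ⟨x⟩ := x
    refine Quotient.sound ?_
    have : 𝒳.p.IsHomLift (𝟙 U.unop) (𝟙 x.1) := IsHomLift.id x.2
    have : 𝒳.p.IsCartesian (𝟙 U.unop) (𝟙 x.1) := inferInstance
    exact nonempty_fiber_iso (𝟙 U.unop) (Iso.refl x) (pullbackMap x.2 (𝟙 U.unop)) (𝟙 x.1)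
  map_comp {U V W} f g := by
    ext x
    obtain ⟨x⟩ := x
    refine Quotient.sound ?_
    exact nonempty_fiber_iso (g.unop ≫ f.unop) (Iso.refl x) (pullbackMap x.2 (g.unop ≫ f.unop))
      (pullbackMap (pullbackObj_proj x.2 f.unop) g.unop ≫ pullbackMap x.2 f.unop)

/-- The sheaf `π₀(𝒳)` of connected components. -/
noncomputable def piZero [𝒳.p.IsFibered] : TBMet.{u}ᵒᵖ ⥤ Type (u + 1) :=
  sheafify lsm.{u} (isoClasses 𝒳)

/-- The functor `μ` from presheaves to extended pseudometric spaces: the left Kan extension along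
the Yoneda embedding of the inclusion of the totally bounded metric spaces. -/
noncomputable def metRe : (TBMet.{u}ᵒᵖ ⥤ Type (u + 1)) ⥤ EPMet.{u + 1} :=
  uliftYoneda.{u + 1}.leftKanExtension TBMet.incl.{u}

/-- The adjunction between `μ` and the functor that sends `N` to the presheaf `Hom(-, N)`. -/
noncomputable def metReAdj :
    metRe.{u} ⊣ Presheaf.restrictedULiftYoneda.{u + 1} TBMet.incl.{u} :=
  Presheaf.uliftYonedaAdjunction.{u + 1} (uliftYoneda.{u + 1}.leftKanExtension TBMet.incl.{u})
    (uliftYoneda.{u + 1}.leftKanExtensionUnit TBMet.incl.{u})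

/-- The space `μ(𝒳) = μ(π₀(𝒳))`. -/
noncomputable def goodModuli [𝒳.p.IsFibered] : EPMet.{u + 1} :=
  metRe.{u}.obj (piZero 𝒳)

/-- The natural morphism from the presheaf of isomorphism classes to `Hom(-, μ(𝒳))`: sheafification
followed by the unit of the adjunction. -/
noncomputable def toGoodModuli [𝒳.p.IsFibered] :
    isoClasses 𝒳 ⟶ (Presheaf.restrictedULiftYoneda.{u + 1} TBMet.incl.{u}).obj (goodModuli 𝒳) :=
  toSheafify lsm.{u} (isoClasses 𝒳) ≫ metReAdj.{u}.unit.app (piZero 𝒳)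

/-- The isomorphism class of an object in its fibre category. -/
def isoClass [𝒳.p.IsFibered] (x : 𝒳.obj) : (isoClasses 𝒳).obj (op (𝒳.p.obj x)) :=
  Quotient.mk _ ⟨x, rfl⟩

theorem isoClasses_map [IsFiberedInGroupoids 𝒳.p] {x y : 𝒳.obj} (f : x ⟶ y) :
    (isoClasses 𝒳).map (𝒳.p.map f).op (isoClass 𝒳 y) = isoClass 𝒳 x := by
  refine Quotient.sound ?_
  let c := IsPreFibered.pullbackMap (p := 𝒳.p) (a := y) rfl (𝒳.p.map f)
  let k := IsCartesian.map 𝒳.p (𝒳.p.map f) c f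
  let a : Fiber 𝒳.p (𝒳.p.obj x) := ⟨x, rfl⟩
  let b : Fiber 𝒳.p (𝒳.p.obj x) := ⟨_, IsPreFibered.pullbackObj_proj (p := 𝒳.p) rfl (𝒳.p.map f)⟩
  let k' : a ⟶ b := ⟨k, inferInstance⟩
  have := IsFiberedInGroupoids.isIso k'
  exact ⟨(asIso k').symm⟩

/-- The good moduli space morphism `π : 𝒳 ⟶ μ(𝒳)`. -/
noncomputable def goodModuliMap [IsFiberedInGroupoids 𝒳.p] :
    BasedFunctor 𝒳 (El.{u + 1, u} (goodModuli 𝒳)) where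
  obj x := ⟨𝒳.p.obj x, LipMap.comp
    (X := 𝒳.p.obj x) (Y := TBMet.incl.{u}.obj (𝒳.p.obj x)) (Z := goodModuli 𝒳)
    (((toGoodModuli 𝒳).app (op (𝒳.p.obj x)) (isoClass 𝒳 x)).down)
    ⟨ULift.up, fun _ _ => le_rfl⟩⟩
  map {x y} f := ⟨𝒳.p.map f, by
    have h := NatTrans.naturality_apply (toGoodModuli 𝒳) (𝒳.p.map f).op (isoClass 𝒳 y)
    rw [isoClasses_map] at h
    refine LipMap.ext (funext fun t => ?_)
    exact (congrArg (fun k => LipMap.toFun (ULift.down k) (ULift.up t)) h).symm⟩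
  map_id x := Subtype.ext (𝒳.p.map_id x)
  map_comp f g := Subtype.ext (𝒳.p.map_comp f g)
  w := rfl

variable {𝒳}

/-- `π : 𝒳 ⟶ M` is a good moduli space: it is universal among morphisms from `𝒳` to extended
pseudometric spaces. -/
def IsGoodModuliSpace {M : EPMet.{u + 1}} (π : BasedFunctor 𝒳 (El.{u + 1, u} M)) : Prop :=
  ∀ (N : EPMet.{u + 1}) (φ : BasedFunctor 𝒳 (El.{u + 1, u} N)),
    ∃! f : M ⟶ N, Nonempty (φ ≅ π.comp (El.map f))

/-- A coarse moduli space is a good moduli space that is a metric space. -/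
structure IsCoarseModuliSpace {M : EPMet.{u + 1}} (π : BasedFunctor 𝒳 (El.{u + 1, u} M)) :
    Prop where
  isGood : IsGoodModuliSpace π
  isMet : EPMet.IsMet.{u + 1, u} M

end Moduli

/-! ## The Gromov--Hausdorff stack -/

/-- A family of compact metric spaces over a totally bounded metric space: a proper submetry. -/
structure GHObj where
  total : Type u
  [str : MetricSpace total]
  base : TBMet.{u}
  proj : LipMap total base
  submetry : IsSubmetry proj
  proper : IsProperMap proj.toFun

namespace GHObj

instance (a : GHObj.{u}) : MetricSpace a.total := a.str

/-- A morphism of families: a commutative square whose induced map from the source to the fibre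
product is an isomorphism. -/
@[ext]
structure Hom (a b : GHObj.{u}) where
  top : LipMap a.total b.total
  bot : LipMap a.base b.base
  comm : ∀ x, b.proj (top x) = bot (a.proj x)
  isometry : Isometry (fun x => (⟨(top x, a.proj x), comm x⟩ :
    TBMet.FibProd b.proj.toFun bot.toFun))
  surjective : Function.Surjective (fun x => (⟨(top x, a.proj x), comm x⟩ :
    TBMet.FibProd b.proj.toFun bot.toFun))

theorem Hom.edist_eq {a b : GHObj.{u}} (f : Hom a b) (x y : a.total) :
    edist x y = max (edist (f.top x) (f.top y)) (edist (a.proj x) (a.proj y)) :=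
  (f.isometry x y).symm

theorem Hom.exists_eq {a b : GHObj.{u}} (f : Hom a b) (y : b.total) (t : a.base)
    (h : b.proj y = f.bot t) : ∃ x, f.top x = y ∧ a.proj x = t := by
  obtain ⟨x, hx⟩ := f.surjective ⟨(y, t), h⟩
  exact ⟨x, congrArg (fun q => q.1.1) hx, congrArg (fun q => q.1.2) hx⟩

/-- A square with the metric and surjectivity properties of a fibre product. -/
def Hom.mk' {a b : GHObj.{u}} (top : LipMap a.total b.total) (bot : LipMap a.base b.base)
    (comm : ∀ x, b.proj (top x) = bot (a.proj x))
    (h₁ : ∀ x y, edist x y = max (edist (top x) (top y)) (edist (a.proj x) (a.proj y)))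
    (h₂ : ∀ y t, b.proj y = bot t → ∃ x, top x = y ∧ a.proj x = t) : Hom a b where
  top := top
  bot := bot
  comm := comm
  isometry x y := (h₁ x y).symm
  surjective := by
    rintro ⟨⟨y, t⟩, h⟩
    obtain ⟨x, rfl, rfl⟩ := h₂ y t h
    exact ⟨x, rfl⟩

instance : Category GHObj.{u} where
  Hom := Hom
  id a := Hom.mk' (LipMap.id _) (LipMap.id _) (fun _ => rfl)
    (fun x y => (max_eq_left (a.proj.edist_le x y)).symm) (fun y _ h => ⟨y, rfl, h⟩)
  comp {a b c} f g := Hom.mk' (g.top.comp f.top) (g.bot.comp f.bot)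
    (fun x => (g.comm _).trans (congrArg g.bot.toFun (f.comm x)))
    (fun x y => by
      have := f.bot.edist_le (a.proj x) (a.proj y)
      rw [f.edist_eq, g.edist_eq, f.comm, f.comm, max_assoc, max_eq_right this]
      rfl)
    (fun z t h => by
      obtain ⟨y, rfl, hy⟩ := g.exists_eq z (f.bot t) h
      obtain ⟨x, rfl, rfl⟩ := f.exists_eq y t hy
      exact ⟨x, rfl, rfl⟩)

end GHObj

/-- The functor that sends a family to its base. -/
def GHObj.toBase : GHObj.{u} ⥤ TBMet.{u} where
  obj a := a.base
  map f := f.bot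

/-- The Gromov--Hausdorff stack. -/
def GH : BasedCategory.{u, u + 1} TBMet.{u} :=
  BasedCategory.ofFunctor GHObj.toBase.{u}

theorem IsSubmetry.projSnd {X B T : Type*} [MetricSpace X] [MetricSpace B] [MetricSpace T]
    {p : LipMap X B} (hp : IsSubmetry p) (hp' : IsProperMap p.toFun) (f : LipMap T B) :
    IsSubmetry (projSnd p.toFun f.toFun) := by
  have key : ∀ (x : X) (t t' : T), p x = f t → ∃ x', p x' = f t' ∧ edist x x' ≤ edist t t' := by
    intro x t t' h
    have hne : (p.toFun ⁻¹' {f t'}).Nonempty := hp.1 (f t')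
    obtain ⟨x', hx', he⟩ := (hp'.isCompact_preimage isCompact_singleton).exists_infEDist_eq_edist
      hne x
    refine ⟨x', hx', ?_⟩
    rw [← he]
    exact (Metric.infEDist_le_hausdorffEDist_of_mem (s := p.toFun ⁻¹' {f t}) h).trans
      ((hp.2 _ _).1.trans (f.edist_le t t'))
  have key' : ∀ t t' : T, ∀ q ∈ (GHStack.projSnd p.toFun f.toFun).toFun ⁻¹' {t},
      ∃ q' ∈ (GHStack.projSnd p.toFun f.toFun).toFun ⁻¹' {t'}, edist q q' ≤ edist t t' := by
    rintro _ t' ⟨⟨x, t⟩, h⟩ rfl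
    obtain ⟨x', hx', he⟩ := key x t t' h
    exact ⟨⟨(x', t'), hx'⟩, rfl, (max_le he le_rfl : max (edist x x') (edist t t') ≤ _)⟩
  refine ⟨fun t => ?_, fun t t' => ⟨?_, edist_lt_top _ _⟩⟩
  · obtain ⟨x, hx⟩ := hp.1 (f t)
    exact ⟨⟨(x, t), hx⟩, rfl⟩
  · refine Metric.hausdorffEDist_le_of_mem_edist (key' t t') ?_
    rw [edist_comm]
    exact key' t' t

theorem isProperMap_projSnd {X B T : Type*} [MetricSpace X] [MetricSpace B] [MetricSpace T]
    {p : LipMap X B} (hp : IsProperMap p.toFun) (f : LipMap T B) :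
    IsProperMap (projSnd p.toFun f.toFun).toFun := by
  refine isProperMap_iff_ultrafilter.2 ⟨(projSnd p.toFun f.toFun).continuous, ?_⟩
  intro 𝒰 t ht
  have h : Filter.Tendsto p.toFun (𝒰.map (projFst p.toFun f.toFun).toFun) (nhds (f t)) := by
    have := (f.continuous.tendsto t).comp ht
    rw [Ultrafilter.coe_map, Filter.tendsto_map'_iff]
    exact this.congr fun q => q.2.symm
  obtain ⟨x, hx, hxU⟩ := (isProperMap_iff_ultrafilter.1 hp).2 h
  refine ⟨⟨(x, t), hx⟩, rfl, ?_⟩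
  rw [nhds_subtype_eq_comap, nhds_prod_eq]
  exact Filter.map_le_iff_le_comap.1
    (Filter.Tendsto.prodMk (f := (𝒰 : Filter (TBMet.FibProd p.toFun f.toFun))) hxU ht)

/-- The base change of a family. -/
def GHObj.baseChange (a : GHObj.{u}) {T : TBMet.{u}} (f : LipMap T a.base) : GHObj.{u} where
  total := TBMet.FibProd a.proj.toFun f.toFun
  base := T
  proj := projSnd a.proj.toFun f.toFun
  submetry := a.submetry.projSnd a.proper f
  proper := isProperMap_projSnd a.proper f

/-- The projection from the base change. -/
def GHObj.baseChangeMap (a : GHObj.{u}) {T : TBMet.{u}} (f : LipMap T a.base) :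
    a.baseChange f ⟶ a :=
  Hom.mk' (projFst a.proj.toFun f.toFun) f (fun q => q.2) (fun _ _ => rfl)
    (fun y t h => ⟨⟨(y, t), h⟩, rfl, rfl⟩)

namespace GHObj

theorem Hom.exists_lift {a b c : GHObj.{u}} (F : Hom a b) (F' : Hom c b) (G : LipMap c.base a.base)
    (hG : ∀ t, F.bot (G t) = F'.bot t) :
    ∃ χ : Hom c a, χ.bot = G ∧ ∀ z, F.top (χ.top z) = F'.top z := by
  have hex : ∀ z, ∃ x, F.top x = F'.top z ∧ a.proj x = G (c.proj z) :=
    fun z => F.exists_eq _ _ ((F'.comm z).trans (hG _).symm)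
  choose k hk₁ hk₂ using hex
  have hdist : ∀ z z', edist (k z) (k z') =
      max (edist (F'.top z) (F'.top z')) (edist (G (c.proj z)) (G (c.proj z'))) := by
    intro z z'
    rw [F.edist_eq, hk₁, hk₁, hk₂, hk₂]
  refine ⟨Hom.mk' ⟨k, fun z z' => ?_⟩ G hk₂ (fun z z' => ?_) (fun x t h => ?_), rfl, hk₁⟩
  · rw [hdist]
    exact max_le (F'.top.edist_le _ _) ((G.edist_le _ _).trans (c.proj.edist_le _ _))
  · change _ = max (edist (k z) (k z')) _
    rw [hdist, max_assoc, max_eq_right (G.edist_le _ _)]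
    exact F'.edist_eq z z'
  · have h' : b.proj (F.top x) = F'.bot t := by rw [F.comm, h, hG]
    obtain ⟨z, hz, rfl⟩ := F'.exists_eq _ _ h'
    refine ⟨z, ?_, rfl⟩
    refine edist_eq_zero.1 ?_
    rw [F.edist_eq]
    change max (edist (F.top (k z)) _) (edist (a.proj (k z)) _) = 0
    rw [hk₁, hk₂, hz, h, edist_self, edist_self, max_self]

theorem Hom.lift_unique {a b c : GHObj.{u}} (F : Hom a b) (χ χ' : Hom c a) (h : χ.bot = χ'.bot)
    (h' : ∀ z, F.top (χ.top z) = F.top (χ'.top z)) : χ = χ' := by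
  refine Hom.ext (LipMap.ext (funext fun z => ?_)) h
  refine edist_eq_zero.1 ?_
  rw [F.edist_eq, h', χ.comm, χ'.comm, h, edist_self, edist_self, max_self]

theorem isStronglyCartesian {a b : GHObj.{u}} (φ : a ⟶ b) :
    toBase.{u}.IsStronglyCartesian (toBase.{u}.map φ) φ where
  universal_property' {c} g φ' hφ' := by
    have hg : g ≫ toBase.{u}.map φ = toBase.{u}.map φ' := IsHomLift.eq_of_isHomLift _ _ _
    obtain ⟨χ, rfl, hχ⟩ := Hom.exists_lift (a := a) (b := b) (c := c) φ φ' g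
      (fun t => congrArg (fun k => LipMap.toFun k t) hg)
    refine ⟨χ, ⟨?_, Hom.ext (LipMap.ext (funext hχ)) hg⟩, ?_⟩
    · exact (inferInstance : toBase.{u}.IsHomLift
        (toBase.{u}.map (X := c) (Y := a) χ) (show c ⟶ a from χ))
    · rintro ψ ⟨hψ, hψφ⟩
      have h₁ : χ.bot = toBase.{u}.map ψ :=
        IsHomLift.eq_of_isHomLift (p := toBase.{u}) (a := c) (b := a) χ.bot ψ
      refine Hom.lift_unique φ ψ χ h₁.symm fun z => ?_
      exact (congrArg (fun f : Hom c b => f.top z) hψφ).trans (hχ z).symm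

instance : IsFiberedInGroupoids toBase.{u} where
  toIsFibered := IsFibered.of_exists_isStronglyCartesian fun a _ f =>
    ⟨baseChange a f, baseChangeMap a f, isStronglyCartesian (baseChangeMap a f)⟩
  isIso {S a b} φ := by
    obtain ⟨φ, hφ⟩ := φ
    have := isStronglyCartesian φ
    have hi : IsIso (toBase.{u}.map φ) := by
      rw [IsHomLift.fac' toBase.{u} (𝟙 S) φ]
      infer_instance
    have := IsStronglyCartesian.isIso_of_base_isIso toBase.{u} (toBase.{u}.map φ) φ
    exact ⟨⟨inv φ, inferInstance⟩, Subtype.ext (IsIso.hom_inv_id φ),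
      Subtype.ext (IsIso.inv_hom_id φ)⟩

end GHObj

instance : IsFiberedInGroupoids GH.{u}.p :=
  inferInstanceAs (IsFiberedInGroupoids GHObj.toBase.{u})

end GHStack

namespace GHStack

/-! ## Criteria for proper submetries -/

/-! Descent. Points of the base belong to every covering sieve, so a descent datum determines the
fibre over each point, and the glued total space is the disjoint union of these fibres. Its distance
is the infimum of the distances of simultaneous representatives in members of the datum. In a
member, the distance is the maximum of the glued distance and the distance of the base points
(`Rep.dist_eq`). A covering lifts three points at once with arbitrarily small loss in two base
distances, which yields the triangle inequality; two-point lifts give the submetry property.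
Isomorphisms glue for the same reason (`existsUnique_glue`).

Atlas. Let `Ambient` be the union of a tower of spaces of bounded functions, starting from a point.
An isometric embedding into stage `n` of a nonempty part of a compact space extends to the whole
space with values in stage `n + 1` (`exists_isometry_extension`). The compact sets lying in some
stage, with the Hausdorff distance, form the metric space `Hyper`, which carries a tautological
family. Given a family over `{0, s}` whose fibre over `0` is a given compact set, the inclusion of
that fibre extends to the total space, and the images of the two fibres are the required lift: hence
the tautological family is a formal submetry. The points of `Hyper` of a given isometry type form
the preimage of a point under a continuous map to the Gromov–Hausdorff space, hence a closed set.

Moduli. A presheaf `Hom(-, N)` is a sheaf, so sheafification followed by Kan extension has the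
universal property of a good moduli space. The value of a morphism from `GH` to `N` on a fibre
depends only on the isometry class of that fibre, and is 1-Lipschitz in it, because an optimal
coupling makes two compact spaces the fibres of a family over `{0, r}` with `r` their
Gromov–Hausdorff distance. So `μ(GH)` is isometric to the Gromov–Hausdorff space, which is a
complete metric space. -/

theorem isSubmetry_of_exists_lift {X B : Type*} [MetricSpace X] [MetricSpace B] (f : LipMap X B)
    (hs : Function.Surjective f.toFun)
    (h : ∀ (x : X) (b : B) (ε : ℝ), 0 < ε → ∃ x', f x' = b ∧ dist x x' < dist (f x) b + ε) :
    IsSubmetry f := by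
  refine ⟨hs, fun b₀ b₁ => ⟨?_, edist_lt_top _ _⟩⟩
  have key : ∀ (b₀ b₁ : B) (ε : ℝ), 0 < ε → ∀ x ∈ f.toFun ⁻¹' {b₀}, ∃ y ∈ f.toFun ⁻¹' {b₁},
      edist x y ≤ ENNReal.ofReal (dist b₀ b₁ + ε) := by
    rintro _ b₁ ε hε x rfl
    obtain ⟨x', hx', hd⟩ := h x b₁ ε hε
    exact ⟨x', hx', by rw [edist_dist]; exact ENNReal.ofReal_le_ofReal hd.le⟩
  refine ENNReal.le_of_forall_pos_le_add fun ε hε _ => ?_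
  have he : edist b₀ b₁ + ε = ENNReal.ofReal (dist b₀ b₁ + ε) := by
    rw [ENNReal.ofReal_add dist_nonneg ε.coe_nonneg, edist_dist, ENNReal.ofReal_coe_nnreal]
  rw [he]
  refine Metric.hausdorffEDist_le_of_mem_edist (key b₀ b₁ ε hε) ?_
  rw [dist_comm]
  exact key b₁ b₀ ε hε

/-- For closedness, points of the closed set lying over base points that tend to `b` are moved into
the fibre over `b` by distances tending to zero. Compactness of that fibre gives a convergent
subsequence, and the original points have the same limit. -/
theorem isProperMap_of_exists_lift {X B : Type*} [MetricSpace X] [MetricSpace B] (f : LipMap X B)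
    (hc : ∀ b, IsCompact (f.toFun ⁻¹' {b}))
    (h : ∀ (x : X) (b : B) (ε : ℝ), 0 < ε → ∃ x', f x' = b ∧ dist x x' < dist (f x) b + ε) :
    IsProperMap f.toFun := by
  refine isProperMap_iff_isClosedMap_and_compact_fibers.2 ⟨f.continuous, ?_, fun {b} => hc b⟩
  intro C hC
  refine isClosed_of_closure_subset fun b hb => ?_
  have h₁ : ∀ n : ℕ, ∃ c ∈ C, ∃ x, f x = b ∧ dist c x < 2 / (n + 1 : ℝ) := by
    intro n
    have hn : (0 : ℝ) < 1 / (n + 1 : ℝ) := by positivity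
    obtain ⟨_, ⟨c, hc, rfl⟩, hd⟩ := Metric.mem_closure_iff.1 hb _ hn
    obtain ⟨x, hx, hdx⟩ := h c b _ hn
    refine ⟨c, hc, x, hx, hdx.trans ?_⟩
    rw [dist_comm] at hd
    have : 2 / (n + 1 : ℝ) = 1 / (n + 1 : ℝ) + 1 / (n + 1 : ℝ) := by ring
    rw [this]
    exact add_lt_add_left hd _
  choose c hcC x hx hd using h₁
  obtain ⟨y, hy, φ, hφ, hlim⟩ := (hc b).isSeqCompact (x := x) hx
  refine ⟨y, ?_, hy⟩
  refine hC.mem_of_tendsto (f := fun n => c (φ n)) (b := Filter.atTop) ?_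
    (Filter.Eventually.of_forall fun n => hcC _)
  rw [tendsto_iff_dist_tendsto_zero] at hlim ⊢
  have h0 : Filter.Tendsto (fun n : ℕ => 2 / (n + 1 : ℝ)) Filter.atTop (nhds 0) := by
    have := tendsto_one_div_add_atTop_nhds_zero_nat.const_mul (2 : ℝ)
    simpa [div_eq_mul_inv] using this
  refine squeeze_zero (fun _ => dist_nonneg) (fun n => ?_)
    (by simpa using (h0.comp hφ.tendsto_atTop).add hlim)
  exact (dist_triangle _ (x (φ n)) _).trans (add_le_add_left (hd _).le _)

/-- A compact fibre attains the distance to a point, so no `ε` is lost. -/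
theorem IsSubmetry.exists_lift {X B : Type*} [MetricSpace X] [MetricSpace B]
    {f : LipMap X B} (hf : IsSubmetry f) (hf' : IsProperMap f.toFun) (x : X) (b : B) :
    ∃ x', f x' = b ∧ dist x x' ≤ dist (f x) b := by
  obtain ⟨x', hx', he⟩ := (hf'.isCompact_preimage isCompact_singleton).exists_infEDist_eq_edist
    (hf.1 b : (f.toFun ⁻¹' {b}).Nonempty) x
  refine ⟨x', hx', ?_⟩
  have : edist x x' ≤ edist (f x) b := by
    rw [← he]
    exact (Metric.infEDist_le_hausdorffEDist_of_mem (s := f.toFun ⁻¹' {f x}) rfl).trans (hf.2 _ _).1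
  rwa [edist_dist, edist_dist, ENNReal.ofReal_le_ofReal_iff dist_nonneg] at this

namespace GHObj

/-! ## Families and their morphisms over a prescribed base -/

/-- The structure map of a family whose base is identified with `T`. -/
def projTo (a : GHObj.{u}) {T : TBMet.{u}} (h : a.base = T) : LipMap a.total T :=
  h ▸ a.proj

theorem submetry_projTo (a : GHObj.{u}) {T : TBMet.{u}} (h : a.base = T) :
    IsSubmetry (a.projTo h) := by
  subst h
  exact a.submetry

theorem proper_projTo (a : GHObj.{u}) {T : TBMet.{u}} (h : a.base = T) :
    IsProperMap (a.projTo h).toFun := by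
  subst h
  exact a.proper

section HomLift

variable {a b : GHObj.{u}} {T T' : TBMet.{u}}

theorem Hom.dist_eq (f : Hom a b) (x y : a.total) :
    dist x y = max (dist (f.top x) (f.top y)) (dist (a.proj x) (a.proj y)) :=
  (f.isometry.dist_eq x y).symm

theorem eq_bot_of_isHomLift (g : a.base ⟶ b.base) (f : a ⟶ b) (h : toBase.{u}.IsHomLift g f) :
    g = Hom.bot f :=
  @IsHomLift.eq_of_isHomLift _ _ _ _ toBase.{u} a b g f h

theorem projTo_top (g : T ⟶ T') (f : a ⟶ b) [toBase.{u}.IsHomLift g f] (ha : a.base = T)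
    (hb : b.base = T') (x : a.total) :
    b.projTo hb (Hom.top f x) = LipMap.toFun g (a.projTo ha x) := by
  subst ha hb
  rw [eq_bot_of_isHomLift g f ‹_›]
  exact Hom.comm f x

theorem dist_eq_of_isHomLift (g : T ⟶ T') (f : a ⟶ b) [toBase.{u}.IsHomLift g f] (ha : a.base = T)
    (x y : a.total) :
    dist x y = max (dist (Hom.top f x) (Hom.top f y)) (dist (a.projTo ha x) (a.projTo ha y)) := by
  subst ha
  exact Hom.dist_eq f x y

theorem exists_of_isHomLift (g : T ⟶ T') (f : a ⟶ b) [toBase.{u}.IsHomLift g f] (ha : a.base = T)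
    (hb : b.base = T') (y : b.total) (t : T) (h : b.projTo hb y = LipMap.toFun g t) :
    ∃ x, Hom.top f x = y ∧ a.projTo ha x = t := by
  subst ha hb
  rw [eq_bot_of_isHomLift g f ‹_›] at h
  exact Hom.exists_eq f y t h

theorem hom_ext_of_isHomLift (g : T ⟶ T') (f f' : a ⟶ b) [toBase.{u}.IsHomLift g f]
    [toBase.{u}.IsHomLift g f'] (h : ∀ x, Hom.top f x = Hom.top f' x) : f = f' := by
  obtain rfl : a.base = T := IsHomLift.domain_eq toBase.{u} g f
  obtain rfl : b.base = T' := IsHomLift.codomain_eq toBase.{u} g f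
  refine Hom.ext (LipMap.ext (funext h)) ?_
  exact (eq_bot_of_isHomLift g f ‹_›).symm.trans (eq_bot_of_isHomLift g f' ‹_›)

theorem exists_isHomLift (ha : a.base = T) (hb : b.base = T') (g : T ⟶ T')
    (top : a.total → b.total) (comm : ∀ x, b.projTo hb (top x) = LipMap.toFun g (a.projTo ha x))
    (h₁ : ∀ x y, dist x y = max (dist (top x) (top y)) (dist (a.projTo ha x) (a.projTo ha y)))
    (h₂ : ∀ y t, b.projTo hb y = LipMap.toFun g t → ∃ x, top x = y ∧ a.projTo ha x = t) :
    ∃ f : a ⟶ b, toBase.{u}.IsHomLift g f ∧ ∀ x, Hom.top f x = top x := by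
  subst ha hb
  let f : a ⟶ b := Hom.mk' (LipMap.ofDist top fun x y => (le_max_left _ _).trans (h₁ x y).ge) g comm
    (fun x y => by
      change _ = max (edist (top x) (top y)) _
      rw [edist_dist, edist_dist, edist_dist, h₁, ENNReal.ofReal_max]
      rfl) h₂
  exact ⟨f, (inferInstance : toBase.{u}.IsHomLift (toBase.{u}.map f) f), fun _ => rfl⟩

end HomLift

end GHObj

/-! ## Points and lifts along covering sieves -/

theorem TBMet.ptMap_comp {X Y : TBMet.{u}} (f : X ⟶ Y) (x : X) :
    (TBMet.ptMap x : TBMet.pt.{u} ⟶ X) ≫ f = TBMet.ptMap (LipMap.toFun f x) := rfl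

theorem lsm_exists_lift {X : TBMet.{u}} {S : Sieve X} (hS : S ∈ lsm.{u} X) (x₁ x₂ x₃ : X) {ε : ℝ}
    (hε : 0 < ε) : ∃ (U : TBMet.{u}) (f : U ⟶ X), S f ∧
    ∃ u₁ u₂ u₃ : U, LipMap.toFun f u₁ = x₁ ∧ LipMap.toFun f u₂ = x₂ ∧ LipMap.toFun f u₃ = x₃ ∧
      dist u₁ u₂ < dist x₁ x₂ + ε ∧ dist u₂ u₃ < dist x₂ x₃ + ε := by
  obtain ⟨R, hR, hRS⟩ := hS
  obtain ⟨U, f, hf, h⟩ := hR.lift x₁ x₂ x₃ ε hε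
  exact ⟨U, f, hRS _ _ hf, h⟩

theorem lsm_ptMap_mem {X : TBMet.{u}} {S : Sieve X} (hS : S ∈ lsm.{u} X) (x : X) :
    S (TBMet.ptMap x : TBMet.pt.{u} ⟶ X) := by
  obtain ⟨U, f, hf, u, -, -, rfl, -⟩ := lsm_exists_lift hS x x x one_pos
  rw [← TBMet.ptMap_comp f u]
  exact S.downward_closed hf _

namespace GHObj

/-! ## Descent for isomorphisms of families -/

/-- Distances in a pulled back family are maxima with a base distance `e`, which exceeds the true
base distance `t` by less than any prescribed `ε`. This removes that term. -/
theorem max_le_of_forall_eps {a b t : ℝ} (ht : t ≤ b)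
    (h : ∀ ε > 0, ∃ e < t + ε, a ≤ max b e) : a ≤ b := by
  refine le_of_forall_pos_le_add fun ε hε => ?_
  obtain ⟨e, he, ha⟩ := h ε hε
  exact ha.trans (max_le (by linarith) (by linarith))

/-- The fibre of `x` over a point factors through every arrow to `x` whose base hits that point.
Local morphisms given on different arrows can therefore be compared on a common fibre. -/
theorem exists_comp_eq_baseChangeMap {x c : GHObj.{u}} (α : c ⟶ x) (t : c.base) :
    ∃ k : x.baseChange (TBMet.ptMap (Hom.bot α t)) ⟶ c,
      k ≫ α = x.baseChangeMap (TBMet.ptMap (Hom.bot α t)) ∧ Hom.bot k = TBMet.ptMap t := by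
  obtain ⟨k, hk, hk'⟩ := Hom.exists_lift (a := c) (b := x)
    (c := x.baseChange (TBMet.ptMap (Hom.bot α t))) α
    (x.baseChangeMap (TBMet.ptMap (Hom.bot α t))) (TBMet.ptMap t) (fun _ => rfl)
  refine ⟨k, Hom.ext (LipMap.ext (funext hk')) ?_, hk⟩
  change LipMap.comp (Hom.bot α) (Hom.bot k) = _
  rw [hk]
  rfl

section GlueHom

variable {x y : GHObj.{u}} (hy : y.base = x.base) {S : Sieve x.base}
  (φ : ∀ (c : GHObj.{u}) (α : c ⟶ x), S (Hom.bot α) → (c ⟶ y))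

/-- The relation between points of two families induced by a family of local morphisms. -/
def GlueRel (p : x.total) (q : y.total) : Prop :=
  ∃ (c : GHObj.{u}) (α : c ⟶ x) (h : S (Hom.bot α)) (z : c.total),
    Hom.top α z = p ∧ Hom.top (φ c α h) z = q

variable (hS : S ∈ lsm.{u} x.base)
  (hφ : ∀ c α h, toBase.{u}.IsHomLift (Hom.bot α : c.base ⟶ x.base) (φ c α h))
  (hcomp : ∀ (c c' : GHObj.{u}) (γ : c' ⟶ c) (α : c ⟶ x) (h : S (Hom.bot α))
    (h' : S (Hom.bot (γ ≫ α))), φ c' (γ ≫ α) h' = γ ≫ φ c α h)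

include hcomp in
-- Both values agree with the value of the local morphism on the one-point base change of `x` at the
-- image of `p`, by compatibility along the factorization through it.
theorem GlueRel.functional {p : x.total} {q q' : y.total} (h : GlueRel φ p q)
    (h' : GlueRel φ p q') : q = q' := by
  have key : ∀ (b : x.base) (c : GHObj.{u}) (α : c ⟶ x) (h : S (Hom.bot α)) (z : c.total)
      (_ : Hom.top α z = p) (_ : Hom.bot α (c.proj z) = b)
      (hb : S (Hom.bot (x.baseChangeMap (TBMet.ptMap b))))
      (w : (x.baseChange (TBMet.ptMap b)).total) (_ : w.1.1 = p),
      Hom.top (φ _ _ hb) w = Hom.top (φ c α h) z := by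
    rintro _ c α h z hz rfl hb w hw
    obtain ⟨k, hk, hkb⟩ := exists_comp_eq_baseChangeMap α (c.proj z)
    have h₁ : ∀ (β : x.baseChange (TBMet.ptMap (Hom.bot α (c.proj z))) ⟶ x)
        (hβ : S (Hom.bot β)), k ≫ α = β → φ _ β hβ = k ≫ φ c α h := by
      rintro _ hβ rfl
      exact hcomp _ _ _ _ _ _
    rw [h₁ _ hb hk]
    change Hom.top (φ c α h) (Hom.top k w) = _
    congr 1
    refine edist_eq_zero.1 ?_
    rw [Hom.edist_eq α, Hom.comm, hkb]
    have h₂ : Hom.top α (Hom.top k w) = w.1.1 :=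
      congrArg (fun f : Hom (x.baseChange (TBMet.ptMap (Hom.bot α (c.proj z)))) x => f.top w) hk
    rw [h₂, hw, hz]
    change max _ (edist (c.proj z) (c.proj z)) = 0
    rw [edist_self, edist_self, max_self]
  obtain ⟨c, α, hα, z, hz, rfl⟩ := h
  obtain ⟨c', α', hα', z', hz', rfl⟩ := h'
  have hb : Hom.bot α (c.proj z) = x.proj p := by rw [← Hom.comm, hz]
  have hb' : Hom.bot α' (c'.proj z') = x.proj p := by rw [← Hom.comm, hz']
  have hpt : S (Hom.bot (x.baseChangeMap (TBMet.ptMap (x.proj p)))) := by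
    rw [← hb]
    exact S.downward_closed hα (TBMet.ptMap (c.proj z))
  exact (key _ c α hα z hz hb hpt ⟨(p, PUnit.unit), rfl⟩ rfl).symm.trans
    (key _ c' α' hα' z' hz' hb' hpt ⟨(p, PUnit.unit), rfl⟩ rfl)

include hφ in
theorem GlueRel.projTo_eq {p : x.total} {q : y.total} (h : GlueRel φ p q) :
    y.projTo hy q = x.proj p := by
  obtain ⟨c, α, hα, z, rfl, rfl⟩ := h
  have := hφ c α hα
  rw [projTo_top (Hom.bot α : c.base ⟶ x.base) (φ c α hα) rfl hy]
  exact (Hom.comm α z).symm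

include hS in
theorem GlueRel.exists_right (p : x.total) : ∃ q, GlueRel φ p q := by
  obtain ⟨U, f, hf, u, -, -, hu, -⟩ := lsm_exists_lift hS (x.proj p) (x.proj p) (x.proj p) one_pos
  exact ⟨_, x.baseChange f, x.baseChangeMap f, hf, ⟨(p, u), hu.symm⟩, rfl, rfl⟩

include hS hφ hy in
theorem GlueRel.exists_left (q : y.total) : ∃ p, GlueRel φ p q := by
  obtain ⟨U, f, hf, u, -, -, hu, -⟩ :=
    lsm_exists_lift hS (y.projTo hy q) (y.projTo hy q) (y.projTo hy q) one_pos
  have := hφ (x.baseChange f) (x.baseChangeMap f) hf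
  obtain ⟨z, hz, -⟩ := exists_of_isHomLift (Hom.bot (x.baseChangeMap f))
    (φ _ (x.baseChangeMap f) hf) rfl hy q u hu.symm
  exact ⟨_, _, _, hf, z, rfl, hz⟩

include hS hφ hcomp hy in
-- In the base change along a member of the sieve, both distances have the same maximum with the
-- distance of the lifted base points. That distance can be taken arbitrarily close to the one in
-- the base, which neither distance falls below.
theorem GlueRel.dist_eq {p p' : x.total} {q q' : y.total} (h : GlueRel φ p q)
    (h' : GlueRel φ p' q') : dist p p' = dist q q' := by
  have key : ∀ ε > 0, ∃ e < dist (x.proj p) (x.proj p') + ε,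
      max (dist p p') e = max (dist q q') e := by
    intro ε hε
    obtain ⟨U, f, hf, u, u', -, hu, hu', -, hd, -⟩ :=
      lsm_exists_lift hS (x.proj p) (x.proj p') (x.proj p) hε
    refine ⟨dist u u', hd, ?_⟩
    have := hφ (x.baseChange f) (x.baseChangeMap f) hf
    let z : (x.baseChange f).total := ⟨(p, u), hu.symm⟩
    let z' : (x.baseChange f).total := ⟨(p', u'), hu'.symm⟩
    have hz := GlueRel.functional φ hcomp h ⟨_, x.baseChangeMap f, hf, z, rfl, rfl⟩
    have hz' := GlueRel.functional φ hcomp h' ⟨_, x.baseChangeMap f, hf, z', rfl, rfl⟩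
    have := dist_eq_of_isHomLift (Hom.bot (x.baseChangeMap f)) (φ _ (x.baseChangeMap f) hf) rfl z z'
    rw [← hz, ← hz'] at this
    exact this
  have hp := x.proj.dist_le p p'
  have hq : dist (x.proj p) (x.proj p') ≤ dist q q' := by
    rw [← h.projTo_eq hy φ hφ, ← h'.projTo_eq hy φ hφ]
    exact (y.projTo hy).dist_le q q'
  refine le_antisymm (max_le_of_forall_eps hq fun ε hε => ?_)
    (max_le_of_forall_eps hp fun ε hε => ?_)
  · obtain ⟨e, he, h⟩ := key ε hε
    exact ⟨e, he, h ▸ le_max_left _ _⟩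
  · obtain ⟨e, he, h⟩ := key ε hε
    exact ⟨e, he, h ▸ le_max_left _ _⟩

include hy hS hφ hcomp in
-- `GlueRel` is the graph of a bijective isometry over the base. An arrow to `y` is determined by
-- its underlying map, and every point of `x` comes from some local piece, so the glued arrow is
-- unique.
theorem existsUnique_glue : ∃! ψ : x ⟶ y, toBase.{u}.IsHomLift (𝟙 x.base) ψ ∧
    ∀ c α h, α ≫ ψ = φ c α h := by
  choose ψ hψ using GlueRel.exists_right φ hS
  have hcomm : ∀ p, y.projTo hy (ψ p) = x.proj p := fun p => (hψ p).projTo_eq hy φ hφ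
  have hdist : ∀ p p', dist p p' = dist (ψ p) (ψ p') := fun p p' =>
    GlueRel.dist_eq hy φ hS hφ hcomp (hψ p) (hψ p')
  obtain ⟨Ψ, hΨ, hΨ'⟩ := exists_isHomLift (a := x) (b := y) rfl hy (𝟙 x.base) ψ hcomm
    (fun p p' => by
      rw [← hdist, max_eq_left]
      exact x.proj.dist_le p p') (fun q t h => by
      obtain ⟨p, hp⟩ := GlueRel.exists_left hy φ hS hφ q
      obtain rfl := GlueRel.functional φ hcomp hp (hψ p)
      exact ⟨p, rfl, (hcomm p).symm.trans h⟩)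
  refine ⟨Ψ, ⟨hΨ, fun c α h => ?_⟩, ?_⟩
  · have := hφ c α h
    have h₁ : toBase.{u}.IsHomLift (Hom.bot α : c.base ⟶ x.base) α :=
      (inferInstance : toBase.{u}.IsHomLift (toBase.{u}.map α) α)
    have h₂ : toBase.{u}.IsHomLift ((Hom.bot α : c.base ⟶ x.base) ≫ 𝟙 x.base) (α ≫ Ψ) :=
      inferInstance
    rw [Category.comp_id] at h₂
    refine hom_ext_of_isHomLift (Hom.bot α : c.base ⟶ x.base) _ _ fun z => ?_
    change Hom.top Ψ (Hom.top α z) = _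
    rw [hΨ']
    exact GlueRel.functional φ hcomp (hψ _) ⟨c, α, h, z, rfl, rfl⟩
  · rintro Ψ' ⟨hl, hΨ''⟩
    refine hom_ext_of_isHomLift (𝟙 x.base) _ _ fun p => ?_
    obtain ⟨q, c, α, h, z, rfl, -⟩ := GlueRel.exists_right φ hS p
    have h₁ : Hom.top (α ≫ Ψ') z = Hom.top (φ c α h) z := by rw [hΨ'']
    refine Eq.trans h₁ ?_
    rw [hΨ']
    exact GlueRel.functional φ hcomp ⟨c, α, h, z, rfl, rfl⟩ (hψ _)

end GlueHom

/-! ## Effectivity of descent data of families -/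

section Descent

variable {U : TBMet.{u}} {S : Sieve U}

/-- The structure map of a member of a sieve, as a 1-Lipschitz map. -/
def sieveMap (t : S.arrows.category) : LipMap t.obj.left U := t.obj.hom

/-- The map underlying an arrow between members of a sieve. -/
def sieveHom {t t' : S.arrows.category} (k : t ⟶ t') : LipMap t.obj.left t'.obj.left := k.hom.left

theorem sieveMap_sieveHom {t t' : S.arrows.category} (k : t ⟶ t') (v : t.obj.left) :
    sieveMap t' (sieveHom k v) = sieveMap t v :=
  congrArg (fun f : LipMap t.obj.left U => f v) (Over.w k.hom)

theorem exists_sieveHom {t t' : S.arrows.category} (f : LipMap t.obj.left t'.obj.left)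
    (h : ∀ v, sieveMap t' (f v) = sieveMap t v) : ∃ k : t ⟶ t', sieveHom k = f :=
  ⟨ObjectProperty.homMk (Over.homMk f (TBMet.hom_ext h)), rfl⟩

theorem sieveHom_injective {t t' : S.arrows.category} {k k' : t ⟶ t'}
    (h : ∀ v, sieveHom k v = sieveHom k' v) : k = k' :=
  ObjectProperty.hom_ext _ (Over.OverMorphism.ext (TBMet.hom_ext h))

/-- A point of the base as a member of a covering sieve. -/
def sievePt (hS : S ∈ lsm.{u} U) (u : U) : S.arrows.category :=
  Presieve.categoryMk _ (TBMet.ptMap u : TBMet.pt.{u} ⟶ U) (lsm_ptMap_mem hS u)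

/-- Fibre products of members of a sieve are again members; they serve as common refinements on
which representatives in `t` and in `t'` are compared. -/
theorem exists_fibProd (t t' : S.arrows.category) : ∃ (s : S.arrows.category) (k : s ⟶ t)
    (k' : s ⟶ t'), (∀ v v', sieveMap t v = sieveMap t' v' →
      ∃ w, sieveHom k w = v ∧ sieveHom k' w = v') ∧
      ∀ w w', dist w w' =
        max (dist (sieveHom k w) (sieveHom k w')) (dist (sieveHom k' w) (sieveHom k' w')) := by
  let p : TBMet.fibProd t.obj.hom t'.obj.hom ⟶ t.obj.left :=
    (projFst (LipMap.toFun t.obj.hom) (LipMap.toFun t'.obj.hom) : LipMap _ _)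
  let p' : TBMet.fibProd t.obj.hom t'.obj.hom ⟶ t'.obj.left :=
    (projSnd (LipMap.toFun t.obj.hom) (LipMap.toFun t'.obj.hom) : LipMap _ _)
  let s : S.arrows.category := Presieve.categoryMk _ (p ≫ t.obj.hom)
    (S.downward_closed t.property p)
  obtain ⟨k, hk⟩ := exists_sieveHom (t := s) (t' := t) p fun _ => rfl
  obtain ⟨k', hk'⟩ := exists_sieveHom (t := s) (t' := t') p' fun w => w.2.symm
  refine ⟨s, k, k', fun v v' h => ⟨⟨(v, v'), h⟩, ?_, ?_⟩, fun w w' => ?_⟩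
  · rw [hk]; rfl
  · rw [hk']; rfl
  · rw [hk, hk']; rfl

variable (D : S.arrows.category ⥤ GHObj.{u}) (hD : ∀ t, (D.obj t).base = t.obj.left)
  (hl : ∀ (t t' : S.arrows.category) (k : t ⟶ t'), toBase.{u}.IsHomLift k.hom.left (D.map k))

/-- The projection of a member of a descent datum. -/
def descProj (t : S.arrows.category) : LipMap (D.obj t).total t.obj.left :=
  (D.obj t).projTo (hD t)

/-- The transition map of a descent datum. -/
def descMap {t t' : S.arrows.category} (k : t ⟶ t') : LipMap (D.obj t).total (D.obj t').total :=
  Hom.top (D.map k)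

theorem descMap_comp {t t' t'' : S.arrows.category} (k : t ⟶ t') (k' : t' ⟶ t'')
    (b : (D.obj t).total) : descMap D (k ≫ k') b = descMap D k' (descMap D k b) := by
  unfold descMap
  rw [D.map_comp]
  rfl

theorem descMap_id (t : S.arrows.category) (b : (D.obj t).total) : descMap D (𝟙 t) b = b := by
  unfold descMap
  rw [D.map_id]
  rfl

include hl in
theorem descProj_descMap {t t' : S.arrows.category} (k : t ⟶ t') (b : (D.obj t).total) :
    descProj D hD t' (descMap D k b) = sieveHom k (descProj D hD t b) :=
  have := hl t t' k
  projTo_top k.hom.left (D.map k) (hD t) (hD t') b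

include hl in
theorem dist_descMap {t t' : S.arrows.category} (k : t ⟶ t') (b b' : (D.obj t).total) :
    dist b b' = max (dist (descMap D k b) (descMap D k b'))
      (dist (descProj D hD t b) (descProj D hD t b')) :=
  have := hl t t' k
  dist_eq_of_isHomLift k.hom.left (D.map k) (hD t) b b'

include hl in
theorem exists_descMap_eq {t t' : S.arrows.category} (k : t ⟶ t') (b : (D.obj t').total)
    (v : t.obj.left) (h : descProj D hD t' b = sieveHom k v) :
    ∃ a, descMap D k a = b ∧ descProj D hD t a = v :=
  have := hl t t' k
  exists_of_isHomLift k.hom.left (D.map k) (hD t) (hD t') b v h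

variable (hS : S ∈ lsm.{u} U)

/-- The points of the glued family. -/
def DescPt : Type u := Σ x : U, (D.obj (sievePt hS x)).total

variable {hS}

/-- A point of a member of the descent datum represents a point of the glued family. -/
def Rep (a : DescPt D hS) {t : S.arrows.category} (b : (D.obj t).total) : Prop :=
  ∃ k : sievePt hS a.1 ⟶ t, descMap D k a.2 = b

variable {D}

include hD hl

theorem Rep.base {a : DescPt D hS} {t : S.arrows.category} {b : (D.obj t).total} (h : Rep D a b) :
    sieveMap t (descProj D hD t b) = a.1 := by
  obtain ⟨k, rfl⟩ := h
  rw [descProj_descMap D hD hl, sieveMap_sieveHom]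
  rfl

theorem exists_rep (t : S.arrows.category) (b : (D.obj t).total) :
    ∃ a : DescPt D hS, Rep D a b := by
  obtain ⟨k, hk⟩ := exists_sieveHom (t := sievePt hS (sieveMap t (descProj D hD t b))) (t' := t)
    (TBMet.ptMap (descProj D hD t b)) (fun _ => rfl)
  obtain ⟨a, ha, -⟩ := exists_descMap_eq D hD hl k b PUnit.unit (by rw [hk]; rfl)
  exact ⟨⟨_, a⟩, k, ha⟩

theorem exists_rep_of_base (a : DescPt D hS) (t : S.arrows.category) (v : t.obj.left)
    (h : sieveMap t v = a.1) : ∃ b : (D.obj t).total, descProj D hD t b = v ∧ Rep D a b := by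
  obtain ⟨k, hk⟩ := exists_sieveHom (t := sievePt hS a.1) (t' := t) (TBMet.ptMap v) (fun _ => h)
  refine ⟨descMap D k a.2, ?_, k, rfl⟩
  rw [descProj_descMap D hD hl, hk]
  rfl

/-- With `exists_rep`, `exists_rep_of_base` and `Rep.unique_left`, this identifies the total space
over `t`, as a set, with the fibre product of the glued set and the base of `t`. -/
theorem Rep.unique_right {a : DescPt D hS} {t : S.arrows.category} {b b' : (D.obj t).total}
    (h : Rep D a b) (h' : Rep D a b') (hb : descProj D hD t b = descProj D hD t b') : b = b' := by
  obtain ⟨k, rfl⟩ := h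
  obtain ⟨k', rfl⟩ := h'
  rw [descProj_descMap D hD hl, descProj_descMap D hD hl] at hb
  rw [sieveHom_injective (k := k) (k' := k') fun _ => hb]

theorem Rep.unique_left {a a' : DescPt D hS} {t : S.arrows.category} {b : (D.obj t).total}
    (h : Rep D a b) (h' : Rep D a' b) : a = a' := by
  have hx := (h.base hD hl).symm.trans (h'.base hD hl)
  obtain ⟨x, a⟩ := a
  obtain ⟨x', a'⟩ := a'
  obtain rfl : x = x' := hx
  congr 1
  obtain ⟨k, rfl⟩ := h
  obtain ⟨k', hk'⟩ := h'
  -- Both arrows send the point to the projection of `b`, so they coincide.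
  have hb : sieveHom k PUnit.unit = sieveHom k' PUnit.unit := by
    have h₁ := descProj_descMap D hD hl k a
    rw [← hk'] at h₁
    exact h₁.symm.trans (descProj_descMap D hD hl k' a')
  obtain rfl := sieveHom_injective (k := k) (k' := k') fun _ => hb
  refine dist_eq_zero.1 ?_
  rw [dist_descMap D hD hl k, hk']
  change max (dist _ _) (dist PUnit.unit.{u + 1} PUnit.unit) = 0
  simp

omit hl hD in
theorem Rep.map {a : DescPt D hS} {t t' : S.arrows.category} {b : (D.obj t).total}
    (h : Rep D a b) (k : t ⟶ t') : Rep D a (descMap D k b) := by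
  obtain ⟨k', rfl⟩ := h
  exact ⟨k' ≫ k, descMap_comp D k' k _⟩

omit hl hD in
theorem rep_self (a : DescPt D hS) : Rep D a a.2 := ⟨𝟙 _, descMap_id D _ _⟩

/-- Both sides are the distance of the representatives in the family over the fibre product of `t`
and `t'`. That distance is a maximum involving both base distances, of which each is absorbed by the
distance upstairs in its own member. -/
theorem Rep.max_dist {a a' : DescPt D hS} {t t' : S.arrows.category} {b b' : (D.obj t).total}
    {c c' : (D.obj t').total} (hb : Rep D a b) (hb' : Rep D a' b') (hc : Rep D a c)
    (hc' : Rep D a' c') :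
    max (dist b b') (dist (descProj D hD t' c) (descProj D hD t' c')) =
      max (dist c c') (dist (descProj D hD t b) (descProj D hD t b')) := by
  obtain ⟨s, k, k', hw, hd⟩ := exists_fibProd t t'
  have key : ∀ {a : DescPt D hS} {b : (D.obj t).total} {c : (D.obj t').total}, Rep D a b →
      Rep D a c → ∃ e : (D.obj s).total, descMap D k e = b ∧ descMap D k' e = c := by
    intro a b c hb hc
    obtain ⟨w, hw₁, hw₂⟩ := hw (descProj D hD t b) (descProj D hD t' c)
      ((hb.base hD hl).trans (hc.base hD hl).symm)
    obtain ⟨e, he, hae⟩ := exists_rep_of_base hD hl a s w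
      (by rw [← sieveMap_sieveHom k, hw₁, hb.base hD hl])
    refine ⟨e, (hae.map k).unique_right hD hl hb ?_, (hae.map k').unique_right hD hl hc ?_⟩
    · rw [descProj_descMap D hD hl, he, hw₁]
    · rw [descProj_descMap D hD hl, he, hw₂]
  obtain ⟨e, rfl, rfl⟩ := key hb hc
  obtain ⟨e', rfl, rfl⟩ := key hb' hc'
  have h₁ := dist_descMap D hD hl k e e'
  have h₂ := dist_descMap D hD hl k' e e'
  have h₃ := (descProj D hD t).dist_le (descMap D k e) (descMap D k e')
  have h₄ := (descProj D hD t').dist_le (descMap D k' e) (descMap D k' e')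
  rw [hd, ← descProj_descMap D hD hl, ← descProj_descMap D hD hl, ← descProj_descMap D hD hl,
    ← descProj_descMap D hD hl] at h₁ h₂
  rw [← max_assoc, max_eq_left h₃] at h₁
  rw [max_comm (dist (descProj D hD t _) _), ← max_assoc, max_eq_left h₄] at h₂
  exact h₁.symm.trans h₂

omit hl hD

variable (D hS) in
/-- The distance of two points of the glued family: the infimum of the distances of simultaneous
representatives. -/
noncomputable instance : Dist (DescPt D hS) where
  dist a a' := sInf {r | ∃ (t : S.arrows.category) (b b' : (D.obj t).total),
    Rep D a b ∧ Rep D a' b' ∧ dist b b' = r}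

theorem Rep.dist_le {a a' : DescPt D hS} {t : S.arrows.category} {b b' : (D.obj t).total}
    (hb : Rep D a b) (hb' : Rep D a' b') : dist a a' ≤ dist b b' :=
  csInf_le ⟨0, by rintro _ ⟨t, b, b', -, -, rfl⟩; exact dist_nonneg⟩ ⟨t, b, b', hb, hb', rfl⟩

include hD hl

/-- The three-point condition on coverings enters here: a triangle must be represented in a single
member of the datum. -/
theorem exists_rep₃ (a₁ a₂ a₃ : DescPt D hS) {ε : ℝ} (hε : 0 < ε) :
    ∃ (t : S.arrows.category) (b₁ b₂ b₃ : (D.obj t).total), Rep D a₁ b₁ ∧ Rep D a₂ b₂ ∧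
      Rep D a₃ b₃ ∧
      dist (descProj D hD t b₁) (descProj D hD t b₂) < dist a₁.1 a₂.1 + ε ∧
      dist (descProj D hD t b₂) (descProj D hD t b₃) < dist a₂.1 a₃.1 + ε := by
  obtain ⟨V, f, hf, v₁, v₂, v₃, h₁, h₂, h₃, h₁₂, h₂₃⟩ := lsm_exists_lift hS a₁.1 a₂.1 a₃.1 hε
  let t : S.arrows.category := Presieve.categoryMk _ f hf
  obtain ⟨b₁, e₁, r₁⟩ := exists_rep_of_base hD hl a₁ t v₁ h₁
  obtain ⟨b₂, e₂, r₂⟩ := exists_rep_of_base hD hl a₂ t v₂ h₂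
  obtain ⟨b₃, e₃, r₃⟩ := exists_rep_of_base hD hl a₃ t v₃ h₃
  refine ⟨t, b₁, b₂, b₃, r₁, r₂, r₃, ?_, ?_⟩
  · rw [e₁, e₂]; exact h₁₂
  · rw [e₂, e₃]; exact h₂₃

theorem le_dist_descPt {a a' : DescPt D hS} {r : ℝ}
    (h : ∀ (t : S.arrows.category) (b b' : (D.obj t).total), Rep D a b → Rep D a' b' →
      r ≤ dist b b') : r ≤ dist a a' := by
  -- Simultaneous representatives exist, so the infimum is not the default value `0` of the empty
  -- set.
  obtain ⟨t, b, -, b', hb, -, hb', -, -⟩ := exists_rep₃ hD hl a a a' one_pos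
  refine le_csInf ⟨_, t, b, b', hb, hb', rfl⟩ ?_
  rintro _ ⟨t, b, b', hb, hb', rfl⟩
  exact h t b b' hb hb'

theorem dist_fst_le (a a' : DescPt D hS) : dist a.1 a'.1 ≤ dist a a' := by
  refine le_dist_descPt hD hl fun t b b' hb hb' => ?_
  rw [← hb.base hD hl, ← hb'.base hD hl]
  exact ((sieveMap t).dist_le _ _).trans ((descProj D hD t).dist_le _ _)

/-- If `dist b b'` exceeded both terms, some other pair of representatives would be closer than `b`
and `b'`. By `Rep.max_dist` the distance `dist b b'` is at most the maximum of that smaller distance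
and the base distance, a contradiction. -/
theorem Rep.dist_eq {a a' : DescPt D hS} {t : S.arrows.category} {b b' : (D.obj t).total}
    (hb : Rep D a b) (hb' : Rep D a' b') :
    dist b b' = max (dist a a') (dist (descProj D hD t b) (descProj D hD t b')) := by
  refine le_antisymm ?_ (max_le (hb.dist_le hb') ((descProj D hD t).dist_le _ _))
  by_contra! hlt
  obtain ⟨h₁, h₂⟩ := max_lt_iff.1 hlt
  refine h₁.not_ge (le_dist_descPt hD hl fun t' c c' hc hc' => ?_)
  have h := hb.max_dist hD hl hb' hc hc'
  by_contra! hlt'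
  exact (max_lt hlt' h₂).not_ge (h ▸ le_max_left _ _)

/-- The glued family is a metric space. -/
noncomputable abbrev descMetric : MetricSpace (DescPt D hS) where
  dist_self a := by
    refine le_antisymm ?_ (le_dist_descPt hD hl fun _ _ _ _ _ => dist_nonneg)
    exact ((rep_self a).dist_le (rep_self a)).trans_eq (dist_self _)
  dist_comm a a' := by
    have key : ∀ a a' : DescPt D hS, dist a a' ≤ dist a' a := fun a a' =>
      le_dist_descPt hD hl fun t b b' hb hb' => (hb'.dist_le hb).trans_eq (dist_comm _ _)
    exact le_antisymm (key a a') (key a' a)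
  dist_triangle a₁ a₂ a₃ := by
    refine le_of_forall_pos_le_add fun ε hε => ?_
    -- Since base distances are bounded by glued distances, `Rep.dist_eq` makes two sides of this
    -- triangle exceed the glued ones by at most `ε / 2`.
    obtain ⟨t, b₁, b₂, b₃, h₁, h₂, h₃, h₁₂, h₂₃⟩ := exists_rep₃ hD hl a₁ a₂ a₃ (half_pos hε)
    have e₁ : dist b₁ b₂ ≤ dist a₁ a₂ + ε / 2 := by
      rw [h₁.dist_eq hD hl h₂]
      exact max_le (by linarith) (h₁₂.le.trans (add_le_add_left (dist_fst_le hD hl _ _) _))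
    have e₂ : dist b₂ b₃ ≤ dist a₂ a₃ + ε / 2 := by
      rw [h₂.dist_eq hD hl h₃]
      exact max_le (by linarith) (h₂₃.le.trans (add_le_add_left (dist_fst_le hD hl _ _) _))
    have e₃ := h₁.dist_le h₃
    have e₄ := dist_triangle b₁ b₂ b₃
    linarith
  eq_of_dist_eq_zero {a a'} h := by
    have hx : a'.1 = a.1 :=
      (dist_le_zero.1 ((dist_fst_le hD hl a a').trans_eq h)).symm
    -- Both points have representatives in the fibre over their common base point. There the base
    -- distance vanishes, so the distance is the glued one.
    obtain ⟨b, -, hb⟩ := exists_rep_of_base hD hl a' (sievePt hS a.1) PUnit.unit hx.symm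
    have h₁ := (rep_self a).dist_eq hD hl hb
    rw [h] at h₁
    have h₂ : dist a.2 b = 0 := h₁.trans (max_eq_left (dist_self (PUnit.unit.{u + 1})).le)
    rw [← dist_eq_zero.1 h₂] at hb
    exact (rep_self a).unique_left hD hl hb

include hS in
/-- Descent data of families along covering sieves are effective. -/
theorem exists_glue : ∃ (x : GHObj.{u}) (_ : x.base = U) (c : ∀ t : S.arrows.category, D.obj t ⟶ x),
    (∀ t, toBase.{u}.IsHomLift t.obj.hom (c t)) ∧
    ∀ (t t' : S.arrows.category) (k : t ⟶ t'), D.map k ≫ c t' = c t := by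
  let : MetricSpace (DescPt D hS) := descMetric hD hl
  let pr : LipMap (DescPt D hS) U := LipMap.ofDist (fun a => a.1) (dist_fst_le hD hl)
  have hlift : ∀ (a : DescPt D hS) (x : U) (ε : ℝ), 0 < ε →
      ∃ a' : DescPt D hS, pr a' = x ∧ dist a a' < dist (pr a) x + ε := by
    intro a x ε hε
    -- The `ε` is lost only in lifting the two base points to a member of the covering. Inside that
    -- member the proper submetry moves points without loss.
    obtain ⟨V, f, hf, v, v', -, hv, hv', -, hd, -⟩ := lsm_exists_lift hS a.1 x x hε
    let t : S.arrows.category := Presieve.categoryMk _ f hf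
    obtain ⟨b, rfl, hb⟩ := exists_rep_of_base hD hl a t v hv
    obtain ⟨b', rfl, hbb'⟩ := (submetry_projTo _ (hD t)).exists_lift (proper_projTo _ (hD t)) b v'
    obtain ⟨a', ha'⟩ := exists_rep (hS := hS) hD hl t b'
    exact ⟨a', (ha'.base hD hl).symm.trans hv', ((hb.dist_le ha').trans hbb').trans_lt hd⟩
  have hsurj : Function.Surjective pr.toFun := by
    intro x
    obtain ⟨a, -⟩ := (submetry_projTo _ (hD (sievePt hS x))).1 PUnit.unit
    exact ⟨⟨x, a⟩, rfl⟩
  have hcomp : ∀ x, IsCompact (pr.toFun ⁻¹' {x}) := by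
    intro x
    -- The fibre over `x` is the image of the family over the one-point member at `x`, which is
    -- compact by properness.
    have h₁ : IsCompact (Set.univ : Set (D.obj (sievePt hS x)).total) := by
      have := (proper_projTo _ (hD (sievePt hS x))).isCompact_preimage
        (K := Set.univ) (Set.finite_univ (α := PUnit)).isCompact
      simpa using this
    let m : (D.obj (sievePt hS x)).total → DescPt D hS := fun a => ⟨x, a⟩
    have h₂ : LipschitzWith 1 m :=
      LipschitzWith.mk_one fun a a' => (rep_self (m a)).dist_le (rep_self (m a'))
    convert h₁.image h₂.continuous using 1
    ext ⟨x', a⟩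
    constructor
    · rintro rfl
      exact ⟨a, trivial, rfl⟩
    · rintro ⟨a', -, h⟩
      exact (congrArg Sigma.fst h).symm
  let x : GHObj.{u} := ⟨DescPt D hS, U, pr, isSubmetry_of_exists_lift pr hsurj hlift,
    isProperMap_of_exists_lift pr hcomp hlift⟩
  choose r hr using fun (t : S.arrows.category) (b : (D.obj t).total) =>
    exists_rep (hS := hS) hD hl t b
  have hc : ∀ t : S.arrows.category, ∃ f : D.obj t ⟶ x, toBase.{u}.IsHomLift t.obj.hom f ∧
      ∀ b, Hom.top f b = r t b := fun t =>
    exists_isHomLift (b := x) (hD t) rfl t.obj.hom (r t) (fun b => ((hr t b).base hD hl).symm)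
      (fun b b' => (hr t b).dist_eq hD hl (hr t b'))
      (fun a v h => by
        obtain ⟨b, hb, hab⟩ := exists_rep_of_base hD hl a t v h.symm
        exact ⟨b, (hr t b).unique_left hD hl hab, hb⟩)
  choose c hc hc' using hc
  refine ⟨x, rfl, c, hc, fun t t' k => ?_⟩
  have := hl t t' k
  have := hc t
  have := hc t'
  have h₁ : toBase.{u}.IsHomLift (k.hom.left ≫ t'.obj.hom) (D.map k ≫ c t') := inferInstance
  rw [Over.w k.hom] at h₁
  refine hom_ext_of_isHomLift t.obj.hom _ _ fun b => ?_
  change Hom.top (c t') (descMap D k b) = _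
  rw [hc', hc']
  exact (hr t' _).unique_left hD hl ((hr t b).map k)

end Descent

end GHObj

/-- The Gromov--Hausdorff stack is a stack. -/
theorem isStackInGroupoids_GH : IsStackInGroupoids GH.{u} where
  fibered := inferInstance
  glue_hom x y hy S hS φ hφ hcomp :=
    GHObj.existsUnique_glue (x := x) (y := y) hy φ hS hφ hcomp
  effective U S hS D := by
    refine GHObj.exists_glue (S := S) (D := D.toFunctor) (hS := hS) (fun t => D.w_obj t) ?_
    intro t t' k
    have : (sieveCat S).p.IsHomLift k.hom.left k := Functor.IsHomLift.map (p := (sieveCat S).p) k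
    exact D.preserves_isHomLift k.hom.left k

/-! ## A metric space into which all isometries of compact spaces at a finite stage extend -/

theorem exists_lipschitz_extension {A Y : Type*} [MetricSpace A] [MetricSpace Y] {j : A → Y}
    (hj : Isometry j) {f : A → ℝ} (hf : LipschitzWith 1 f) :
    ∃ g : Y → ℝ, LipschitzWith 1 g ∧ ∀ a, g (j a) = f a := by
  -- The value `0` off the range of `j` is irrelevant: only the restriction to the range is
  -- extended.
  have h : LipschitzOnWith 1 (Function.extend j f 0) (Set.range j) := by
    refine LipschitzOnWith.of_dist_le_mul ?_
    rintro _ ⟨a, rfl⟩ _ ⟨b, rfl⟩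
    rw [hj.injective.extend_apply, hj.injective.extend_apply, hj.dist_eq]
    exact hf.dist_le_mul a b
  obtain ⟨g, hg, he⟩ := h.extend_real
  exact ⟨g, hg, fun a => by rw [← he ⟨a, rfl⟩, hj.injective.extend_apply]⟩

/-- The 1-Lipschitz real functions on a metric space. -/
def LipFun (X : Type u) [MetricSpace X] : Type u := {f : X → ℝ // LipschitzWith 1 f}

/-- The space of bounded functions on countably many copies of the set of 1-Lipschitz functions. -/
abbrev NextSpace (X : Type u) [MetricSpace X] : Type u :=
  lp (fun _ : LipFun X × ℕ => ℝ) ∞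

/-- A general Kuratowski embedding: 1-Lipschitz coordinates give a 1-Lipschitz map to the supremum
norm, and `hi` says that they almost realize every distance. -/
theorem exists_isometry_lp {I P : Type*} [MetricSpace P] (g : I → P → ℝ)
    (hg : ∀ i, LipschitzWith 1 (g i)) (hb : ∀ p, ∃ C, ∀ i, |g i p| ≤ C)
    (hi : ∀ p q, ∀ ε > 0, ∃ i, dist p q ≤ dist (g i p) (g i q) + ε) :
    ∃ J : P → lp (fun _ : I => ℝ) ∞, Isometry J ∧ ∀ p i, J p i = g i p := by
  have hmem : ∀ p, Memℓp (fun i => g i p) ∞ := by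
    intro p
    obtain ⟨C, hC⟩ := hb p
    exact memℓp_infty ⟨C, by rintro _ ⟨i, rfl⟩; exact hC i⟩
  refine ⟨fun p => ⟨fun i => g i p, hmem p⟩, Isometry.of_dist_eq fun p q => ?_, fun _ _ => rfl⟩
  refine le_antisymm ?_ ?_
  · rw [dist_eq_norm]
    refine lp.norm_le_of_forall_le dist_nonneg fun i => ?_
    have := (hg i).dist_le_mul p q
    rw [NNReal.coe_one, one_mul, dist_eq_norm] at this
    exact this
  · refine le_of_forall_pos_le_add fun ε hε => ?_
    obtain ⟨i, hi⟩ := hi p q ε hε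
    refine hi.trans (add_le_add_left ?_ _)
    rw [dist_eq_norm, dist_eq_norm]
    exact lp.norm_apply_le_norm ENNReal.top_ne_zero
      ((⟨fun i => g i p, hmem p⟩ : lp (fun _ : I => ℝ) ∞) - ⟨fun i => g i q, hmem q⟩) i

/-- Subtracting the value at `x₀` makes the coordinates bounded at each point; the coordinate given
by the distance from `x` realizes all distances from `x`. -/
theorem exists_isometry_nextSpace (X : Type u) [MetricSpace X] (x₀ : X) :
    ∃ J : X → NextSpace X, Isometry J ∧ ∀ x i, J x i = i.1.1 x - i.1.1 x₀ := by
  refine exists_isometry_lp (fun (i : LipFun X × ℕ) x => i.1.1 x - i.1.1 x₀) (fun i => ?_)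
    (fun x => ⟨dist x x₀, fun i => ?_⟩) (fun x y ε hε => ?_)
  · refine LipschitzWith.mk_one fun x y => ?_
    rw [dist_sub_right]
    simpa using i.1.2.dist_le_mul x y
  · simpa [Real.dist_eq] using i.1.2.dist_le_mul x x₀
  · refine ⟨(⟨fun y => dist x y, LipschitzWith.dist_right x⟩, 0), ?_⟩
    simp only [dist_self, dist_sub_right, Real.dist_eq]
    rw [zero_sub, abs_neg, abs_of_nonneg dist_nonneg]
    linarith

/-- The isometric embedding of a pointed metric space into the next space. -/
noncomputable def nextMap (X : Type u) [MetricSpace X] (x₀ : X) : X → NextSpace X :=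
  (exists_isometry_nextSpace X x₀).choose

theorem isometry_nextMap (X : Type u) [MetricSpace X] (x₀ : X) : Isometry (nextMap X x₀) :=
  (exists_isometry_nextSpace X x₀).choose_spec.1

theorem nextMap_apply (X : Type u) [MetricSpace X] (x₀ x : X) (i : LipFun X × ℕ) :
    nextMap X x₀ x i = i.1.1 x - i.1.1 x₀ :=
  (exists_isometry_nextSpace X x₀).choose_spec.2 x i

/-- Each coordinate of the embedding is prescribed on `A` and extends to a 1-Lipschitz function on
`P`. To make the result isometric, take a dense sequence `p n` in `P` and 1-Lipschitz functions `f
n` on `X` that restrict on `A` to the distance from `p n`. At the index `(f n, n)` the distance from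
`p n`, shifted by a constant, is an admissible extension. The factor `ℕ` in the index set is needed
because different `p n` may have the same `f n`. -/
theorem exists_isometry_extension {X A P : Type*} [MetricSpace X] [MetricSpace A] [Nonempty A]
    [MetricSpace P] [CompactSpace P] (x₀ : X) {i : A → P} (hi : Isometry i) {j : A → X}
    (hj : Isometry j) : ∃ J : P → NextSpace X, Isometry J ∧ ∀ a, J (i a) = nextMap X x₀ (j a) := by
  have : Nonempty P := Nonempty.map i ‹_›
  let p : ℕ → P := TopologicalSpace.denseSeq P
  have h₁ : ∀ n, ∃ f : X → ℝ, LipschitzWith 1 f ∧ ∀ a, f (j a) = dist (p n) (i a) := fun n =>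
    exists_lipschitz_extension hj ((LipschitzWith.dist_right (p n)).comp hi.lipschitz |>.weaken
      (by simp))
  choose f hf hfj using h₁
  have h₂ : ∀ k : LipFun X × ℕ, ∃ g : P → ℝ, LipschitzWith 1 g ∧
      (∀ a, g (i a) = k.1.1 (j a) - k.1.1 x₀) ∧
      (k.1.1 = f k.2 → ∀ q, g q = dist (p k.2) q - k.1.1 x₀) := by
    intro k
    have hL : ∀ c : ℝ, LipschitzWith 1 fun y : ℝ => y - c := fun c =>
      LipschitzWith.mk_one fun y z => by rw [dist_sub_right]
    by_cases hk : k.1.1 = f k.2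
    · refine ⟨fun q => dist (p k.2) q - k.1.1 x₀,
        ((hL _).comp (LipschitzWith.dist_right (p k.2))).weaken (by simp), fun a => ?_,
        fun _ _ => rfl⟩
      rw [hk, hfj]
    · obtain ⟨g, hg, hgi⟩ := exists_lipschitz_extension hi
        (((hL (k.1.1 x₀)).comp (k.1.2.comp hj.lipschitz)).weaken (K' := 1) (by simp))
      exact ⟨g, hg, hgi, fun h => absurd h hk⟩
  choose g hg hgi hgp using h₂
  obtain ⟨a₀⟩ := ‹Nonempty A›
  have hb : ∀ q, ∃ C, ∀ k, |g k q| ≤ C := by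
    -- All coordinates are controlled at `i a₀`, where their values are prescribed, and hence at
    -- `q`; this uses that `A` is nonempty.
    refine fun q => ⟨dist q (i a₀) + dist (j a₀) x₀, fun k => ?_⟩
    have e₁ := (hg k).dist_le_mul q (i a₀)
    have e₂ := k.1.2.dist_le_mul (j a₀) x₀
    rw [NNReal.coe_one, one_mul, Real.dist_eq] at e₁ e₂
    rw [hgi] at e₁
    have := abs_add_le (g k q - (k.1.1 (j a₀) - k.1.1 x₀)) (k.1.1 (j a₀) - k.1.1 x₀)
    rw [sub_add_cancel] at this
    linarith
  have hd : ∀ q q', ∀ ε > 0, ∃ k, dist q q' ≤ dist (g k q) (g k q') + ε := by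
    intro q q' ε hε
    obtain ⟨n, hn⟩ := (TopologicalSpace.denseRange_denseSeq P).exists_dist_lt q (half_pos hε)
    refine ⟨(⟨f n, hf n⟩, n), ?_⟩
    rw [hgp _ rfl, hgp _ rfl, dist_sub_right, Real.dist_eq]
    change dist q (p n) < _ at hn
    have e₁ := dist_triangle q (p n) q'
    have e₂ := neg_abs_le (dist (p n) q - dist (p n) q')
    change _ ≤ |dist (p n) q - dist (p n) q'| + ε
    rw [dist_comm q (p n)] at *
    linarith
  obtain ⟨J, hJ, hJ'⟩ := exists_isometry_lp g hg hb hd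
  refine ⟨J, hJ, fun a => Subtype.ext (funext fun k => ?_)⟩
  exact (hJ' _ _).trans ((hgi _ _).trans (nextMap_apply _ _ _ _).symm)

/-- A pointed metric space. -/
structure PtMet where
  carrier : Type u
  [str : MetricSpace carrier]
  pt : carrier

instance (X : PtMet.{u}) : MetricSpace X.carrier := X.str

/-- The iterates of the construction `NextSpace`, starting from a point. -/
noncomputable def tower : ℕ → PtMet.{u}
  | 0 => ⟨PUnit, PUnit.unit⟩
  | n + 1 => ⟨NextSpace (tower n).carrier, 0⟩

/-- The stages of the tower. -/
def Stage (n : ℕ) : Type u := (tower.{u} n).carrier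

noncomputable instance (n : ℕ) : MetricSpace (Stage.{u} n) := (tower.{u} n).str

/-- The embedding of each stage of the tower into the next one. -/
noncomputable def stageMap (n : ℕ) : Stage.{u} n → Stage.{u} (n + 1) :=
  nextMap (tower.{u} n).carrier (tower.{u} n).pt

theorem isometry_stageMap (n : ℕ) : Isometry (stageMap.{u} n) :=
  isometry_nextMap (tower.{u} n).carrier (tower.{u} n).pt

/-- The union of the tower. -/
abbrev Ambient : Type u := Metric.InductiveLimit isometry_stageMap.{u}

/-- The embedding of a stage into the union. -/
noncomputable def ofStage (n : ℕ) : Stage.{u} n → Ambient.{u} :=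
  Metric.toInductiveLimit isometry_stageMap.{u} n

theorem isometry_ofStage (n : ℕ) : Isometry (ofStage.{u} n) :=
  Metric.toInductiveLimit_isometry _ n

/-- The range stays in a single stage, so that its compact subsets are points of `Hyper` and can
serve as the start of another extension. -/
theorem exists_isometry_ambient {A P : Type*} [MetricSpace A] [Nonempty A] [MetricSpace P]
    [CompactSpace P] {i : A → P} (hi : Isometry i) {n : ℕ} {j : A → Stage.{u} n}
    (hj : Isometry j) : ∃ J : P → Ambient.{u}, Isometry J ∧ (∀ a, J (i a) = ofStage n (j a)) ∧
      Set.range J ⊆ Set.range (ofStage.{u} (n + 1)) := by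
  obtain ⟨J, hJ, hJ'⟩ := exists_isometry_extension (tower.{u} n).pt hi (X := (tower.{u} n).carrier)
    (j := j) hj
  refine ⟨ofStage.{u} (n + 1) ∘ (J : P → Stage.{u} (n + 1)), (isometry_ofStage _).comp hJ,
    fun a => ?_, Set.range_comp_subset_range _ _⟩
  have h := congrFun (Metric.toInductiveLimit_commute isometry_stageMap.{u} n) (j a)
  change ofStage (n + 1) (J (i a)) = _
  rw [hJ']
  exact h

/-! ## Families of compact subsets of a metric space -/

theorem exists_mem_dist_lt {E : Type*} [MetricSpace E] {K L : TopologicalSpace.NonemptyCompacts E}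
    {e : E} (he : e ∈ K) {r : ℝ} (h : dist K L < r) : ∃ e' ∈ L, dist e e' < r :=
  Metric.exists_dist_lt_of_hausdorffDist_lt (s := (K : Set E)) he h
    (Metric.hausdorffEDist_ne_top_of_nonempty_of_bounded K.nonempty L.nonempty
      K.isCompact.isBounded L.isCompact.isBounded)

/-- The family of compact sets parametrized by a 1-Lipschitz map to a hyperspace. -/
noncomputable def GHObj.ofCompacts {E : Type u} [MetricSpace E] {T : TBMet.{u}}
    (m : LipMap T (TopologicalSpace.NonemptyCompacts E)) : GHObj.{u} :=
  let pr : LipMap {q : T × E // q.2 ∈ m q.1} T :=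
    LipMap.ofDist (fun q => q.1.1) fun _ _ => le_max_left _ _
  have hlift : ∀ (q : {q : T × E // q.2 ∈ m q.1}) (t : T) (ε : ℝ), 0 < ε →
      ∃ q', pr q' = t ∧ dist q q' < dist (pr q) t + ε := by
    rintro ⟨⟨t, e⟩, he⟩ t' ε hε
    obtain ⟨e', he', hd⟩ := exists_mem_dist_lt (L := m t') he
      (lt_of_le_of_lt (m.dist_le t t') (lt_add_of_pos_right _ hε))
    exact ⟨⟨(t', e'), he'⟩, rfl,
      (max_lt (lt_add_of_pos_right _ hε) hd : max (dist t t') (dist e e') < dist t t' + ε)⟩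
  { total := {q : T × E // q.2 ∈ m q.1}
    base := T
    proj := pr
    submetry := by
      refine isSubmetry_of_exists_lift pr (fun t => ?_) hlift
      obtain ⟨e, he⟩ := (m t).nonempty
      exact ⟨⟨(t, e), he⟩, rfl⟩
    proper := by
      refine isProperMap_of_exists_lift pr (fun t => ?_) hlift
      rw [Topology.IsEmbedding.subtypeVal.isCompact_iff]
      suffices h : Subtype.val '' (pr.toFun ⁻¹' {t}) = {t} ×ˢ (m t : Set E) by
        rw [h]
        exact isCompact_singleton.prod (m t).isCompact
      refine Set.ext ?_
      rintro ⟨t', e⟩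
      constructor
      · rintro ⟨⟨⟨t'', e'⟩, he⟩, h, h'⟩
        obtain ⟨rfl, rfl⟩ := Prod.mk.inj h'
        obtain rfl : t'' = t := h
        exact ⟨rfl, he⟩
      · rintro ⟨h, he⟩
        obtain rfl : t' = t := h
        exact ⟨⟨(t', e), he⟩, rfl, rfl⟩ }

/-- The nonempty compact sets contained in some stage of the tower. -/
abbrev Hyper : Type u :=
  {K : TopologicalSpace.NonemptyCompacts Ambient.{u} //
    ∃ n, (K : Set Ambient.{u}) ⊆ Set.range (ofStage n)}

namespace Hyper

/-- The pullback of the tautological family over the hyperspace. -/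
noncomputable abbrev family {T : TBMet.{u}} (m : LipMap T Hyper.{u}) : GHObj.{u} :=
  GHObj.ofCompacts (LipMap.comp ⟨Subtype.val, fun _ _ => le_rfl⟩ m)

/-- The tautological family, as a morphism of stacks. -/
noncomputable def toGH : BasedFunctor (El.{u, u} Hyper.{u}) GH.{u} where
  obj a := family (ElObj.map a)
  map {a b} k := GHObj.Hom.mk' (a := family (ElObj.map a)) (b := family (ElObj.map b))
    (LipMap.ofDist (fun q => ⟨(LipMap.toFun k.1 q.1.1, q.1.2),
        (congrArg (fun m : LipMap (ElObj.base a) Hyper.{u} => q.1.2 ∈ (m q.1.1).1) k.2).mpr q.2⟩)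
      fun q q' => max_le_max (LipMap.dist_le k.1 _ _) le_rfl) k.1 (fun _ => rfl)
    (fun q q' => by
      change max (edist q.1.1 q'.1.1) (edist q.1.2 q'.1.2) = max (max (edist
        (LipMap.toFun k.1 q.1.1) (LipMap.toFun k.1 q'.1.1)) (edist q.1.2 q'.1.2))
        (edist q.1.1 q'.1.1)
      rw [max_right_comm, max_eq_right (LipMap.edist_le k.1 _ _)])
    (fun q t h => by
      obtain ⟨⟨t', e⟩, he⟩ := q
      obtain rfl : t' = LipMap.toFun k.1 t := h
      exact ⟨⟨(t, e), (congrArg (fun m : LipMap (ElObj.base a) Hyper.{u} => e ∈ (m t).1) k.2).mp he⟩,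
        rfl, rfl⟩)
  map_id _ := rfl
  map_comp _ _ := rfl
  w := rfl

/-- A family with an isometric embedding of its total space into a stage of the tower is classified
by the hyperspace. -/
theorem exists_classifying (g : GHObj.{u}) {T T' : TBMet.{u}} (hg : g.base = T') (σ : T ⟶ T')
    {J : g.total → Ambient.{u}} (hJ : Isometry J) {n : ℕ}
    (hn : Set.range J ⊆ Set.range (ofStage.{u} n)) :
    ∃ m : LipMap T Hyper.{u},
      (∀ t, ((m t).1 : Set Ambient.{u}) =
        J '' ((g.projTo hg).toFun ⁻¹' {LipMap.toFun σ t})) ∧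
      ∃ γ : family m ⟶ g, GHObj.toBase.{u}.IsHomLift σ γ ∧
        ∀ q, J (GHObj.Hom.top γ q) = q.1.2 := by
  have hs := g.submetry_projTo hg
  have hp := g.proper_projTo hg
  -- Each base point is sent to the image of its fibre. Fibres of a submetry at distance `d` in the
  -- base have Hausdorff distance at most `d`, so this map is 1-Lipschitz.
  let F : T' → Hyper.{u} := fun t => ⟨⟨⟨J '' ((g.projTo hg).toFun ⁻¹' {t}),
    (hp.isCompact_preimage isCompact_singleton).image hJ.continuous⟩,
    Set.Nonempty.image _ (hs.1 t)⟩, n, (Set.image_subset_range _ _).trans hn⟩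
  have hF : ∀ t t', dist (F t) (F t') ≤ dist t t' := by
    intro t t'
    have key : ∀ t t', ∀ e ∈ (F t).1, ∃ e' ∈ (F t').1, dist e e' ≤ dist t t' := by
      rintro _ t' _ ⟨y, rfl, rfl⟩
      obtain ⟨y', rfl, h⟩ := hs.exists_lift hp y t'
      exact ⟨_, ⟨y', rfl, rfl⟩, by rwa [hJ.dist_eq]⟩
    refine Metric.hausdorffDist_le_of_mem_dist dist_nonneg (key t t') fun e he => ?_
    rw [dist_comm]
    exact key t' t e he
  refine ⟨(LipMap.ofDist F hF).comp σ, fun _ => rfl, ?_⟩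
  have hex : ∀ q : (family ((LipMap.ofDist F hF).comp σ)).total, ∃ y,
      g.projTo hg y = LipMap.toFun σ q.1.1 ∧ J y = q.1.2 := fun q => q.2
  choose y hy hJy using hex
  obtain ⟨γ, hγ, hγ'⟩ := GHObj.exists_isHomLift (a := family ((LipMap.ofDist F hF).comp σ)) (b := g)
    rfl hg σ y hy (fun q q' => by
      rw [← hJ.dist_eq, hJy, hJy, max_comm]
      rfl) (fun z t h => ⟨⟨(t, J z), z, h, rfl⟩, hJ.injective (hJy _), rfl⟩)
  exact ⟨γ, hγ, fun q => by rw [hγ', hJy]⟩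

end Hyper

/-! ### The hyperspace as an atlas: formal submetry and separatedness -/

theorem GHObj.compactSpace_total (g : GHObj.{u}) {T : TBMet.{u}} [CompactSpace T] (hg : g.base = T) :
    CompactSpace g.total :=
  ⟨by simpa using (g.proper_projTo hg).isCompact_preimage (K := Set.univ) isCompact_univ⟩

theorem GHObj.nonempty_total (g : GHObj.{u}) {T : TBMet.{u}} [Nonempty T] (hg : g.base = T) :
    Nonempty g.total :=
  ‹Nonempty T›.elim fun t => ⟨((g.submetry_projTo hg).1 t).choose⟩

instance : CompactSpace TBMet.pt.{u} := inferInstanceAs (CompactSpace PUnit)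

instance : Nonempty TBMet.pt.{u} := inferInstanceAs (Nonempty PUnit)

instance : Subsingleton TBMet.pt.{u} := inferInstanceAs (Subsingleton PUnit)

instance (r : ℝ) : CompactSpace (TBMet.two.{u} r) :=
  ⟨(Set.finite_univ (α := ULift.{u} ({0, r} : Set ℝ))).isCompact⟩

theorem TBMet.zero_shrink {r s : ℝ} (hs : 0 < s) (hr : s < r) :
    TBMet.zero.{u} r ≫ TBMet.shrink hs hr = TBMet.zero.{u} s :=
  TBMet.hom_ext fun _ => ULift.ext _ _ (Subtype.ext (mul_zero (s / r)))

/-- A morphism over the identity induces an isomorphism in the fibre category. -/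
theorem nonempty_iso_of_isHomLift {𝒳 : BasedCategory.{v, w} TBMet.{u}}
    [IsFiberedInGroupoids 𝒳.p] {T : TBMet.{u}} {a b : Fiber 𝒳.p T} (f : a.1 ⟶ b.1)
    (hf : 𝒳.p.IsHomLift (𝟙 T) f) : Nonempty (a ≅ b) := by
  let k : a ⟶ b := ⟨f, hf⟩
  have := IsFiberedInGroupoids.isIso k
  exact ⟨asIso k⟩

/-- Both conditions are instances of the extension property of the tower, starting from one point
for essential surjectivity and from the fibre over `0` for lifting. -/
theorem isFormalSubmetry_toGH : IsFormalSubmetry Hyper.toGH.{u} where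
  essSurj := by
    refine ⟨fun y => ?_⟩
    obtain ⟨g, hg⟩ := y
    change GHObj.{u} at g
    have := GHObj.compactSpace_total g hg
    obtain ⟨y₀⟩ := GHObj.nonempty_total g hg
    obtain ⟨J, hJ, -, hn⟩ := exists_isometry_ambient (A := PUnit) (i := fun _ => y₀) (n := 0)
      (j := fun _ => (tower.{u} 0).pt) isometry_subsingleton isometry_subsingleton
    obtain ⟨m, -, γ, hγ, -⟩ := Hyper.exists_classifying g hg (𝟙 TBMet.pt) hJ hn
    exact ⟨⟨⟨TBMet.pt, m⟩, rfl⟩, nonempty_iso_of_isHomLift (𝒳 := GH.{u})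
      (a := (fiberFunctor Hyper.toGH TBMet.pt).obj ⟨⟨TBMet.pt, m⟩, rfl⟩) (b := ⟨g, hg⟩) γ hγ⟩
  lift r s hs hr x g α hα := by
    obtain ⟨T, m⟩ := x
    obtain rfl : T = TBMet.pt := IsHomLift.domain_eq GH.p (TBMet.zero s) α
    change GHObj.{u} at g
    change Hyper.family m ⟶ g at α
    change GHObj.toBase.{u}.IsHomLift (TBMet.zero s) α at hα
    have hg : g.base = TBMet.two s := IsHomLift.codomain_eq GHObj.toBase.{u} (TBMet.zero s) α
    have := GHObj.compactSpace_total g hg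
    let pt : TBMet.pt.{u} := PUnit.unit
    -- The given compact set lies in a stage, so its inclusion is an isometry `j` into that stage;
    -- `α` identifies the set with the fibre of `g` over `0`.
    obtain ⟨n, hK⟩ := (m pt).2
    choose j hj using fun e : (m pt).1 => hK e.2
    let a : (m pt).1 → (Hyper.family m).total := fun e => ⟨(pt, e.1), e.2⟩
    have hi : Isometry fun e : (m pt).1 => GHObj.Hom.top α (a e) := by
      refine Isometry.of_dist_eq fun e e' => ?_
      have h₁ := GHObj.dist_eq_of_isHomLift (TBMet.zero s) α rfl (a e) (a e')
      have h₂ : dist (a e) (a e') = dist e e' := max_eq_right dist_nonneg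
      rw [h₂] at h₁
      exact (max_eq_left dist_nonneg).symm.trans h₁.symm
    have hji : Isometry j := Isometry.of_dist_eq fun e e' => by
      rw [← (isometry_ofStage n).dist_eq, hj, hj]
      rfl
    obtain ⟨J, hJ, hJi, hn⟩ := exists_isometry_ambient hi hji
    obtain ⟨m', hm', γ, hγ, hγ'⟩ := Hyper.exists_classifying g hg (TBMet.shrink hs hr) hJ hn
    -- As `J` extends the inclusion of the fibre over `0`, the new family restricts to the given
    -- compact set itself, not merely to an isometric copy.
    have h₀ : m'.comp (TBMet.zero r) = m := by
      refine LipMap.ext (funext fun t => Subtype.ext (SetLike.coe_injective ?_))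
      obtain rfl : t = pt := rfl
      refine (hm' _).trans ?_
      ext e
      constructor
      · rintro ⟨y, hy, rfl⟩
        obtain ⟨q, rfl, -⟩ := GHObj.exists_of_isHomLift (TBMet.zero s) α rfl hg y pt
          (hy.trans (congrArg (fun f : LipMap _ _ => f pt) (TBMet.zero_shrink hs hr)))
        have := hJi ⟨q.1.2, q.2⟩
        rw [hj] at this
        exact this ▸ q.2
      · intro he
        refine ⟨GHObj.Hom.top α (a ⟨e, he⟩), ?_, ?_⟩
        · refine (GHObj.projTo_top (TBMet.zero s) α rfl hg _).trans ?_
          exact (congrArg (fun f : LipMap _ _ => f pt) (TBMet.zero_shrink hs hr)).symm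
        · exact (hJi ⟨e, he⟩).trans (hj _)
    let β : (⟨TBMet.pt, m⟩ : ElObj.{u, u} Hyper.{u}) ⟶ ⟨TBMet.two r, m'⟩ := ⟨TBMet.zero r, h₀⟩
    have hβ : (El.{u, u} Hyper.{u}).p.IsHomLift (TBMet.zero r) β :=
      Functor.IsHomLift.map (p := (El.{u, u} Hyper.{u}).p) β
    refine ⟨⟨TBMet.two r, m'⟩, β, γ, hβ, hγ, ?_⟩
    have hβ' := Hyper.toGH.preserves_isHomLift (TBMet.zero r) β
    change GHObj.toBase.{u}.IsHomLift (TBMet.zero r) (Hyper.toGH.map β) at hβ'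
    have h₁ : GHObj.toBase.{u}.IsHomLift (TBMet.zero r ≫ TBMet.shrink hs hr)
      ((show Hyper.family m ⟶ Hyper.family m' from Hyper.toGH.map β) ≫ γ) :=
        @IsHomLift.comp _ _ _ _ GHObj.toBase.{u} _ _ _ _ _ _ _ _ _ _ hβ' hγ
    rw [TBMet.zero_shrink hs hr] at h₁
    refine @GHObj.hom_ext_of_isHomLift _ _ _ _ (TBMet.zero s) _ α h₁ hα fun q => ?_
    refine hJ.injective ((hγ' _).trans ?_)
    exact ((hJi ⟨q.1.2, q.2⟩).trans (hj _)).symm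

theorem isNaiveMetricStack_GH : IsNaiveMetricStack GH.{u} :=
  ⟨isStackInGroupoids_GH, _, _, _, isFormalSubmetry_toGH⟩

/-- Compact metric spaces, as families over the point, are isomorphic if and only if they are
isometric. -/
theorem nonempty_fiber_iso_iff {a b : GHObj.{u}} (ha : a.base = TBMet.pt)
    (hb : b.base = TBMet.pt) :
    Nonempty (Fiber.mk (p := GH.{u}.p) ha ≅ Fiber.mk (p := GH.{u}.p) hb) ↔
      Nonempty (a.total ≃ᵢ b.total) := by
  constructor
  · rintro ⟨e⟩
    let f : a ⟶ b := e.hom.1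
    have hf : GHObj.toBase.{u}.IsHomLift (𝟙 TBMet.pt) f := e.hom.2
    have hi : Isometry (GHObj.Hom.top f).toFun := by
      refine Isometry.of_dist_eq fun x y => ?_
      have := GHObj.dist_eq_of_isHomLift (𝟙 TBMet.pt) f ha x y
      rw [Subsingleton.elim (a.projTo ha x) (a.projTo ha y), dist_self,
        max_eq_left dist_nonneg] at this
      exact this.symm
    refine ⟨IsometryEquiv.mk (Equiv.ofBijective _ ⟨hi.injective, fun y => ?_⟩) hi⟩
    obtain ⟨x, hx, -⟩ := GHObj.exists_of_isHomLift (𝟙 TBMet.pt) f ha hb y PUnit.unit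
      (Subsingleton.elim _ _)
    exact ⟨x, hx⟩
  · rintro ⟨e⟩
    obtain ⟨f, hf, -⟩ := GHObj.exists_isHomLift ha hb (𝟙 TBMet.pt) e
      (fun _ => Subsingleton.elim _ _) (fun x y => by
        rw [Subsingleton.elim (a.projTo ha x) (a.projTo ha y), dist_self,
          max_eq_left dist_nonneg, e.isometry.dist_eq])
      (fun y t _ => ⟨e.symm y, e.apply_symm_apply y, Subsingleton.elim _ _⟩)
    exact nonempty_iso_of_isHomLift (𝒳 := GH.{u}) (a := ⟨a, ha⟩) (b := ⟨b, hb⟩) f hf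

/-- The set in question is the preimage of one point under the continuous map that sends a compact
set to its isometry class. -/
theorem isSeparated_GH : IsSeparated GH.{u} := by
  refine ⟨isNaiveMetricStack_GH, _, _, _, isFormalSubmetry_toGH, ?_⟩
  rintro ⟨g, hg⟩
  change GHObj.{u} at g
  have := GHObj.compactSpace_total g hg
  have := GHObj.nonempty_total g hg
  have h₁ : Continuous fun K : Hyper.{u} => K.1.toGHSpace :=
    GromovHausdorff.toGHSpace_continuous.comp continuous_subtype_val
  refine (congrArg IsClosed (Set.ext fun K => ?_)).mpr
    (isClosed_singleton (x := GromovHausdorff.toGHSpace g.total) |>.preimage h₁)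
  refine (nonempty_fiber_iso_iff (a := Hyper.family (TBMet.ptMap.{u} K)) (b := g) rfl hg).trans
    (Iff.trans ?_ (GromovHausdorff.toGHSpace_eq_toGHSpace_iff_isometryEquiv (X := K.1)).symm)
  let e : (Hyper.family (TBMet.ptMap.{u} K)).total ≃ᵢ K.1 :=
    { toFun := fun q => ⟨q.1.2, q.2⟩
      invFun := fun e => ⟨(PUnit.unit, e.1), e.2⟩
      left_inv := fun _ => rfl
      right_inv := fun _ => rfl
      isometry_toFun := Isometry.of_dist_eq fun q q' =>
        (max_eq_right (a := dist q.1.1 q'.1.1) (by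
          rw [Subsingleton.elim q.1.1 q'.1.1, dist_self]
          exact dist_nonneg)).symm }
  exact ⟨fun ⟨f⟩ => ⟨e.symm.trans f⟩, fun ⟨f⟩ => ⟨e.trans f⟩⟩

/-! ## Morphisms of stacks to a space -/

section ElMap

/-- The map of an object of `El N` whose base is identified with `T`. -/
def ElObj.mapTo {N : Type w} [PseudoEMetricSpace N] (a : ElObj.{w, u} N) {T : TBMet.{u}}
    (h : a.base = T) : LipMap T N := h ▸ a.map

theorem ElObj.eq_mk {N : Type w} [PseudoEMetricSpace N] (a : ElObj.{w, u} N) {T : TBMet.{u}}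
    (h : a.base = T) : a = ⟨T, a.mapTo h⟩ := by
  subst h
  rfl

theorem ElObj.mapTo_comp {N : Type w} [PseudoEMetricSpace N] {a b : ElObj.{w, u} N}
    {T T' : TBMet.{u}} (g : T ⟶ T') (k : a ⟶ b) (hk : (El.{w, u} N).p.IsHomLift g k)
    (ha : a.base = T) (hb : b.base = T') : (b.mapTo hb).comp g = a.mapTo ha := by
  subst ha hb
  rw [@IsHomLift.eq_of_isHomLift _ _ _ _ (El.{w, u} N).p a b g k hk]
  exact k.2

variable {𝒳 : BasedCategory.{v, w} TBMet.{u}} {N : Type w} [PseudoEMetricSpace N]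

/-- The 1-Lipschitz map that a morphism of stacks to a space assigns to an object. -/
def elMap (φ : BasedFunctor 𝒳 (El.{w, u} N)) (x : 𝒳.obj) : LipMap (𝒳.p.obj x) N :=
  ElObj.mapTo (φ.obj x) (φ.w_obj x)

theorem elMap_comp (φ : BasedFunctor 𝒳 (El.{w, u} N)) {x y : 𝒳.obj} (k : x ⟶ y) :
    (elMap φ y).comp (𝒳.p.map k) = elMap φ x :=
  ElObj.mapTo_comp (𝒳.p.map k) (φ.map k) (φ.preserves_isHomLift _ _) _ _

/-- The fibre categories of `El N` are discrete, so isomorphic morphisms to a space have equal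
values. This reduces the universal property to one for presheaves of sets. -/
theorem nonempty_iso_iff_elMap (φ ψ : BasedFunctor 𝒳 (El.{w, u} N)) :
    Nonempty (φ ≅ ψ) ↔ ∀ x, elMap φ x = elMap ψ x := by
  constructor
  · rintro ⟨e⟩ x
    exact (ElObj.mapTo_comp (𝟙 (𝒳.p.obj x)) (e.hom.toNatTrans.app x) (e.hom.isHomLift' x)
      (φ.w_obj x) (ψ.w_obj x)).symm
  · intro h
    have he : ∀ x, φ.obj x = ψ.obj x := fun x =>
      (ElObj.eq_mk (φ.obj x) (φ.w_obj x)).trans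
        ((congrArg (ElObj.mk (𝒳.p.obj x)) (h x)).trans (ElObj.eq_mk (ψ.obj x) (ψ.w_obj x)).symm)
    refine ⟨BasedNatIso.mkNatIso (NatIso.ofComponents (fun x => eqToIso (he x)) ?_) ?_⟩
    · intro x y k
      refine Subtype.ext ?_
      change (El.{w, u} N).p.map (φ.map k ≫ eqToHom (he y)) =
        (El.{w, u} N).p.map (eqToHom (he x) ≫ ψ.map k)
      rw [Functor.map_comp, Functor.map_comp, eqToHom_map, eqToHom_map]
      have h₁ := Functor.congr_hom φ.w k
      have h₂ := Functor.congr_hom ψ.w k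
      rw [Functor.comp_map] at h₁ h₂
      rw [h₁, h₂]
      simp
    · intro x
      exact IsHomLift.eqToHom_domain_lift_id (p := (El.{w, u} N).p) (he x) (φ.w_obj x)

end ElMap

/-! ## Spaces are sheaves for the lsm topology -/

/-- A compatible family is determined by its values on points, which lie in every covering sieve.
Lifting two points with arbitrarily small loss shows that the resulting map is 1-Lipschitz. -/
theorem isSheaf_restrictedULiftYoneda (N : EPMet.{u + 1}) :
    Presheaf.IsSheaf lsm.{u} ((Presheaf.restrictedULiftYoneda.{u + 1} TBMet.incl.{u}).obj N) := by
  rw [isSheaf_iff_isSheaf_of_type]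
  intro U S hS x hx
  let val : ∀ {V : TBMet.{u}} (f : V ⟶ U), S f → V → N := fun f hf v =>
    LipMap.toFun (x f hf).down (ULift.up v)
  have hval : ∀ {V : TBMet.{u}} (f : V ⟶ U) (hf : S f) (v v' : V),
      edist (val f hf v) (val f hf v') ≤ edist v v' := fun f hf v v' =>
    LipMap.edist_le (x f hf).down (ULift.up v) (ULift.up v')
  let y : U → N := fun t => val (TBMet.ptMap t) (lsm_ptMap_mem hS t) PUnit.unit
  have hy : ∀ {V : TBMet.{u}} (f : V ⟶ U) (hf : S f) (v : V), val f hf v = y (LipMap.toFun f v) := by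
    intro V f hf v
    have h := hx (TBMet.ptMap v : TBMet.pt ⟶ V) (𝟙 TBMet.pt) hf
      (lsm_ptMap_mem hS (LipMap.toFun f v)) rfl
    exact congrArg (fun z => LipMap.toFun (ULift.down z) (ULift.up PUnit.unit)) h
  have hlip : ∀ t t', edist (y t) (y t') ≤ edist t t' := by
    intro t t'
    refine ENNReal.le_of_forall_pos_le_add fun ε hε _ => ?_
    obtain ⟨V, f, hf, v, v', -, rfl, rfl, -, hd, -⟩ := lsm_exists_lift hS t t' t hε
    rw [← hy f hf, ← hy f hf]
    refine (hval f hf v v').trans ?_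
    rw [edist_dist, edist_dist, ← ENNReal.ofReal_coe_nnreal,
      ← ENNReal.ofReal_add dist_nonneg ε.coe_nonneg]
    exact ENNReal.ofReal_le_ofReal hd.le
  refine ⟨ULift.up (⟨fun t => y t.down, fun t t' => hlip t.down t'.down⟩ :
    LipMap (TBMet.incl.obj U) N), ?_, ?_⟩
  · intro V f hf
    refine ULift.ext _ _ (LipMap.ext (funext fun v => ?_))
    exact (hy f hf v.down).symm
  · intro z hz
    refine ULift.ext _ _ (LipMap.ext (funext fun t => ?_))
    exact congrArg (fun z => LipMap.toFun (ULift.down z) (ULift.up PUnit.unit))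
      (hz (TBMet.ptMap t.down) (lsm_ptMap_mem hS t.down))

/-! ## The good moduli space -/

section Good

variable {𝒳 : BasedCategory.{u, u + 1} TBMet.{u}} [IsFiberedInGroupoids 𝒳.p]

/-- Since `Hom(-, N)` is a sheaf, `Φ` factors uniquely through the sheafification; the adjunction
turns the factorization into a map of spaces. -/
theorem exists_unique_of_isoClasses (N : EPMet.{u + 1}) (Φ : isoClasses 𝒳 ⟶
    (Presheaf.restrictedULiftYoneda.{u + 1} TBMet.incl.{u}).obj N) :
    ∃! f : goodModuli 𝒳 ⟶ N,
      toGoodModuli 𝒳 ≫ (Presheaf.restrictedULiftYoneda.{u + 1} TBMet.incl.{u}).map f = Φ := by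
  have hN := isSheaf_restrictedULiftYoneda N
  have key : ∀ f : metRe.{u}.obj (piZero 𝒳) ⟶ N,
      toGoodModuli 𝒳 ≫ (Presheaf.restrictedULiftYoneda.{u + 1} TBMet.incl.{u}).map f = Φ ↔
        metReAdj.{u}.homEquiv (piZero 𝒳) N f = sheafifyLift lsm.{u} Φ hN := by
    intro f
    rw [Adjunction.homEquiv_unit]
    have hf : toGoodModuli 𝒳 ≫ (Presheaf.restrictedULiftYoneda.{u + 1} TBMet.incl.{u}).map f =
        toSheafify lsm.{u} (isoClasses 𝒳) ≫ metReAdj.{u}.unit.app (piZero 𝒳) ≫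
          (Presheaf.restrictedULiftYoneda.{u + 1} TBMet.incl.{u}).map f := Category.assoc _ _ _
    rw [hf]
    constructor
    · exact fun h => sheafifyLift_unique _ _ _ _ h
    · intro h
      refine Eq.trans (congrArg (fun k => toSheafify lsm.{u} (isoClasses 𝒳) ≫ k) h) ?_
      exact toSheafify_sheafifyLift _ _ _
  refine ⟨(metReAdj.{u}.homEquiv (piZero 𝒳) N).symm (sheafifyLift lsm.{u} Φ hN), ?_, fun f hf => ?_⟩
  · exact (key _).2 (Equiv.apply_symm_apply _ _)
  · exact (Equiv.eq_symm_apply _).2 ((key f).1 hf)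

/-- The transformation of presheaves of sets induced by a morphism from a stack to a space. -/
noncomputable def isoClassesMap {N : EPMet.{u + 1}} (φ : BasedFunctor 𝒳 (El.{u + 1, u} N)) :
    isoClasses 𝒳 ⟶ (Presheaf.restrictedULiftYoneda.{u + 1} TBMet.incl.{u}).obj N where
  app T := TypeCat.ofHom (Quotient.lift (fun x : Fiber 𝒳.p T.unop =>
    ULift.up ((ElObj.mapTo (φ.obj x.1) ((φ.w_obj x.1).trans x.2)).comp
      ⟨ULift.down, fun _ _ => le_rfl⟩ : LipMap (TBMet.incl.obj T.unop) N)) (by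
    rintro x y ⟨e⟩
    have := e.hom.2
    have h := ElObj.mapTo_comp (𝟙 T.unop) (φ.map e.hom.1) (φ.preserves_isHomLift _ _)
      ((φ.w_obj x.1).trans x.2) ((φ.w_obj y.1).trans y.2)
    exact congrArg ULift.up (LipMap.ext (funext fun t =>
      congrArg (fun f : LipMap T.unop N => f t.down) h.symm))))
  naturality T T' g := by
    ext x
    obtain ⟨x⟩ := x
    let k := Functor.IsPreFibered.pullbackMap (p := 𝒳.p) x.2 g.unop
    have h := ElObj.mapTo_comp g.unop (φ.map k) (φ.preserves_isHomLift _ _)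
      ((φ.w_obj _).trans (Functor.IsPreFibered.pullbackObj_proj x.2 g.unop))
      ((φ.w_obj x.1).trans x.2)
    refine ULift.ext _ _ (LipMap.ext (funext fun t => ?_))
    exact (congrArg (fun f : LipMap T'.unop N => f t.down) h).symm

theorem toGoodModuli_comp_eq_iff {N : EPMet.{u + 1}} (φ : BasedFunctor 𝒳 (El.{u + 1, u} N))
    (f : goodModuli 𝒳 ⟶ N) :
    toGoodModuli 𝒳 ≫ (Presheaf.restrictedULiftYoneda.{u + 1} TBMet.incl.{u}).map f =
      isoClassesMap φ ↔ ∀ x, elMap φ x = elMap ((goodModuliMap 𝒳).comp (El.map f)) x := by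
  constructor
  · intro h x
    have h₁ := congrArg (fun k => k.app (op (𝒳.p.obj x)) (isoClass 𝒳 x)) h
    refine LipMap.ext (funext fun t => ?_)
    exact (congrArg (fun k => LipMap.toFun (ULift.down k) (ULift.up t)) h₁).symm
  · intro h
    ext T x
    obtain ⟨T⟩ := T
    obtain ⟨y⟩ := x
    obtain ⟨z, hz⟩ := y
    obtain rfl : 𝒳.p.obj z = T := hz
    refine ULift.ext _ _ (LipMap.ext (funext fun t => ?_))
    exact (congrArg (fun k : LipMap (𝒳.p.obj z) N => k t.down) (h z)).symm

theorem isGoodModuliSpace_goodModuliMap : IsGoodModuliSpace (goodModuliMap 𝒳) := by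
  intro N φ
  obtain ⟨f, hf, hf'⟩ := exists_unique_of_isoClasses N (isoClassesMap φ)
  refine ⟨f, (nonempty_iso_iff_elMap _ _).2 ((toGoodModuli_comp_eq_iff φ f).1 hf), fun g hg => ?_⟩
  exact hf' g ((toGoodModuli_comp_eq_iff φ g).2 ((nonempty_iso_iff_elMap _ _).1 hg))

end Good

/-! ## The Gromov--Hausdorff space as a good moduli space -/

theorem TBMet.dist_pt (x y : TBMet.pt.{u}) : dist x y = 0 := by
  rw [Subsingleton.elim x y, dist_self]

/-- Lifting the universe of a space does not change distances. -/
def isometryEquivULift (X : Type w) [PseudoEMetricSpace X] : ULift.{v} X ≃ᵢ X :=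
  IsometryEquiv.mk Equiv.ulift fun _ _ => rfl

namespace GHObj

/-- The fibre of a family at a point. -/
abbrev FibreAt (a : GHObj.{u}) (t : a.base) : Type u := {x : a.total // a.proj x = t}

instance (a : GHObj.{u}) (t : a.base) : CompactSpace (a.FibreAt t) :=
  isCompact_iff_compactSpace.1 (a.proper.isCompact_preimage (isCompact_singleton (x := t)))

instance (a : GHObj.{u}) (t : a.base) : Nonempty (a.FibreAt t) :=
  ⟨⟨_, (a.submetry.1 t).choose_spec⟩⟩

/-- The isometry class of a fibre. -/
noncomputable def ghPoint (a : GHObj.{u}) (t : a.base) : GromovHausdorff.GHSpace :=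
  GromovHausdorff.toGHSpace (a.FibreAt t)

theorem ghPoint_eq_iff {a b : GHObj.{u}} {t : a.base} {s : b.base} :
    a.ghPoint t = b.ghPoint s ↔ Nonempty (a.FibreAt t ≃ᵢ b.FibreAt s) :=
  GromovHausdorff.toGHSpace_eq_toGHSpace_iff_isometryEquiv

/-- The fibre of a pullback is a fibre of the original family. -/
noncomputable def Hom.fibreEquiv {a b : GHObj.{u}} (f : Hom a b) (t : a.base) :
    a.FibreAt t ≃ᵢ b.FibreAt (f.bot t) :=
  let m : a.FibreAt t → b.FibreAt (f.bot t) := fun x =>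
    ⟨f.top x.1, (f.comm x.1).trans (congrArg f.bot.toFun x.2)⟩
  have hm : Isometry m := Isometry.of_dist_eq fun x y => by
    have h := f.dist_eq x.1 y.1
    rw [x.2, y.2, dist_self, max_eq_left dist_nonneg] at h
    exact h.symm
  IsometryEquiv.mk (Equiv.ofBijective m ⟨hm.injective, fun y => by
    obtain ⟨x, hx, hxt⟩ := f.exists_eq y.1 t y.2
    exact ⟨⟨x, hxt⟩, Subtype.ext hx⟩⟩) hm

theorem Hom.ghPoint_eq {a b : GHObj.{u}} (f : Hom a b) (t : a.base) :
    b.ghPoint (f.bot t) = a.ghPoint t :=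
  ghPoint_eq_iff.2 ⟨(f.fibreEquiv t).symm⟩

/-- The total space contains both fibres isometrically, so their Hausdorff distance there bounds the
Gromov–Hausdorff distance. -/
theorem dist_ghPoint_le (a : GHObj.{u}) (t t' : a.base) :
    dist (a.ghPoint t) (a.ghPoint t') ≤ dist t t' := by
  refine (GromovHausdorff.ghDist_le_hausdorffDist (X := a.FibreAt t) (Y := a.FibreAt t')
    isometry_subtype_coe isometry_subtype_coe).trans ?_
  have hr : ∀ t : a.base, Set.range (Subtype.val : a.FibreAt t → a.total) = {x | a.proj x = t} :=
    fun _ => Subtype.range_coe_subtype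
  rw [hr, hr]
  have key : ∀ t t' : a.base, ∀ x ∈ {x | a.proj x = t}, ∃ y ∈ {x | a.proj x = t'},
      dist x y ≤ dist t t' := by
    rintro _ t' x rfl
    exact a.submetry.exists_lift a.proper x t'
  refine Metric.hausdorffDist_le_of_mem_dist dist_nonneg (key t t') ?_
  rw [dist_comm]
  exact key t' t

/-- The fibre of a family of compact sets. -/
noncomputable def fibreOfCompacts {E : Type u} [MetricSpace E] {T : TBMet.{u}}
    (m : LipMap T (TopologicalSpace.NonemptyCompacts E)) (t : (ofCompacts m).base) :
    (ofCompacts m).FibreAt t ≃ᵢ m t where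
  toFun q := ⟨q.1.1.2, by
    obtain ⟨q, hq⟩ := q
    obtain rfl : q.1.1 = t := hq
    exact q.2⟩
  invFun e := ⟨⟨(t, e.1), e.2⟩, rfl⟩
  left_inv := by
    rintro ⟨⟨⟨t', e⟩, he⟩, h⟩
    obtain rfl : t' = t := h
    rfl
  right_inv _ := rfl
  isometry_toFun := Isometry.of_dist_eq fun q q' => by
    obtain ⟨⟨⟨t₁, e⟩, he⟩, h⟩ := q
    obtain ⟨⟨⟨t₂, e'⟩, he'⟩, h'⟩ := q'
    obtain rfl : t₁ = t := h
    obtain rfl : t₂ = t₁ := h'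
    exact (max_eq_right (a := dist t₂ t₂) (by rw [dist_self]; exact dist_nonneg)).symm

theorem ghPoint_ofCompacts {E : Type u} [MetricSpace E] {T : TBMet.{u}}
    (m : LipMap T (TopologicalSpace.NonemptyCompacts E)) (t : (ofCompacts m).base) :
    (ofCompacts m).ghPoint t = GromovHausdorff.toGHSpace (m t) :=
  GromovHausdorff.toGHSpace_eq_toGHSpace_iff_isometryEquiv.2 ⟨fibreOfCompacts m t⟩

theorem exists_ghPoint_eq (p : GromovHausdorff.GHSpace) :
    ∃ (a : GHObj.{u}) (t : a.base), a.ghPoint t = p := by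
  let X : Type u := ULift.{u} p.Rep
  have : CompactSpace X := (isometryEquivULift p.Rep : X ≃ᵢ p.Rep).toHomeomorph.symm.compactSpace
  let K : TopologicalSpace.NonemptyCompacts X := ⟨⟨Set.univ, isCompact_univ⟩, Set.univ_nonempty⟩
  refine ⟨ofCompacts (TBMet.ptMap K), PUnit.unit, ?_⟩
  refine (ghPoint_ofCompacts _ _).trans (Eq.trans ?_ p.toGHSpace_rep)
  refine GromovHausdorff.toGHSpace_eq_toGHSpace_iff_isometryEquiv.2 ⟨?_⟩
  exact (IsometryEquiv.mk (Equiv.Set.univ X) fun _ _ => rfl).trans (isometryEquivULift _)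

/-- Two compact metric spaces at Gromov--Hausdorff distance `r` are the fibres of a family over
`{0, r}`. -/
theorem exists_family_two (X Y : Type u) [MetricSpace X] [CompactSpace X] [Nonempty X]
    [MetricSpace Y] [CompactSpace Y] [Nonempty Y] : ∃ (c : GHObj.{u}) (t t' : c.base),
    dist t t' ≤ GromovHausdorff.ghDist X Y ∧ c.ghPoint t = GromovHausdorff.toGHSpace X ∧
    c.ghPoint t' = GromovHausdorff.toGHSpace Y := by
  -- At distance zero the space `{0, r}` has only one point; the two spaces are then isometric and
  -- one fibre serves for both.
  by_cases hr : GromovHausdorff.ghDist X Y = 0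
  · obtain ⟨c, t, h⟩ := exists_ghPoint_eq.{u} (GromovHausdorff.toGHSpace X)
    exact ⟨c, t, t, by rw [hr, dist_self], h, h.trans (dist_eq_zero.1 hr)⟩
  let r := GromovHausdorff.ghDist X Y
  have hr₀ : 0 < r := lt_of_le_of_ne dist_nonneg (Ne.symm hr)
  have hl := GromovHausdorff.isometry_optimalGHInjl X Y
  have hr' := GromovHausdorff.isometry_optimalGHInjr X Y
  -- The images in an optimal coupling have Hausdorff distance exactly `r`, so sending `0` to `K`
  -- and `r` to `L` is 1-Lipschitz.
  let K : TopologicalSpace.NonemptyCompacts (GromovHausdorff.OptimalGHCoupling X Y) :=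
    ⟨⟨_, isCompact_range hl.continuous⟩, Set.range_nonempty _⟩
  let L : TopologicalSpace.NonemptyCompacts (GromovHausdorff.OptimalGHCoupling X Y) :=
    ⟨⟨_, isCompact_range hr'.continuous⟩, Set.range_nonempty _⟩
  have hKL : dist K L = r := GromovHausdorff.hausdorffDist_optimal
  classical
  let m : LipMap (TBMet.two.{u} r) (TopologicalSpace.NonemptyCompacts
      (GromovHausdorff.OptimalGHCoupling X Y)) :=
    LipMap.ofDist (fun t => if t.down.1 = 0 then K else L) (by
      rintro ⟨x, hx⟩ ⟨y, hy⟩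
      change dist (if x = 0 then K else L) (if y = 0 then K else L) ≤ |x - y|
      rcases hx with rfl | rfl <;> rcases hy with rfl | rfl
      · simp
      · rw [if_pos rfl, if_neg hr₀.ne', hKL, zero_sub, abs_neg]
        exact le_abs_self _
      · rw [if_pos rfl, if_neg hr₀.ne', dist_comm, hKL, sub_zero]
        exact le_abs_self _
      · simp)
  refine ⟨ofCompacts m, ⟨0, Or.inl rfl⟩, ⟨r, Or.inr rfl⟩, ?_, ?_, ?_⟩
  · change |0 - r| ≤ r
    rw [zero_sub, abs_neg, abs_of_pos hr₀]
  · refine (ghPoint_ofCompacts m ⟨0, Or.inl rfl⟩).trans ?_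
    rw [show m ⟨0, Or.inl rfl⟩ = K from if_pos rfl]
    exact GromovHausdorff.toGHSpace_eq_toGHSpace_iff_isometryEquiv.2
      ⟨hl.isometryEquivOnRange.symm⟩
  · refine (ghPoint_ofCompacts m ⟨r, Or.inr rfl⟩).trans ?_
    rw [show m ⟨r, Or.inr rfl⟩ = L from if_neg hr₀.ne']
    exact GromovHausdorff.toGHSpace_eq_toGHSpace_iff_isometryEquiv.2
      ⟨hr'.isometryEquivOnRange.symm⟩

end GHObj

/-- The morphism from the Gromov--Hausdorff stack to the Gromov--Hausdorff space. -/
noncomputable def toGHSpace :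
    BasedFunctor GH.{u} (El.{u + 1, u} (ULift.{u + 1} GromovHausdorff.GHSpace)) where
  obj a := ⟨GHObj.base a, LipMap.ofDist (fun t => ⟨GHObj.ghPoint a t⟩) (GHObj.dist_ghPoint_le a)⟩
  map {a b} f := ⟨GHObj.Hom.bot f, LipMap.ext (funext fun t =>
    congrArg ULift.up (GHObj.Hom.ghPoint_eq (a := a) (b := b) f t))⟩
  map_id _ := rfl
  map_comp _ _ := rfl
  w := rfl

/-! ### Morphisms from the Gromov–Hausdorff stack to a space -/

section Values

variable {N : Type (u + 1)} [PseudoEMetricSpace N] (φ : BasedFunctor GH.{u} (El.{u + 1, u} N))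

/-- The value of a morphism from the Gromov--Hausdorff stack to a space on a fibre of a family. -/
def ghValue (a : GHObj.{u}) (t : a.base) : N := elMap φ a t

theorem ghValue_hom {a b : GHObj.{u}} (f : a ⟶ b) (t : a.base) :
    ghValue φ b (GHObj.Hom.bot f t) = ghValue φ a t :=
  congrArg (fun k : LipMap a.base N => k t) (elMap_comp φ (x := a) (y := b) f)

/-- An isometry of fibres is a morphism between the base changes to the point, and values are
invariant under morphisms of families. -/
theorem ghValue_eq {a b : GHObj.{u}} {t : a.base} {s : b.base} (h : a.ghPoint t = b.ghPoint s) :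
    ghValue φ a t = ghValue φ b s := by
  obtain ⟨e⟩ := GHObj.ghPoint_eq_iff.1 h
  let A := a.baseChange (TBMet.ptMap t)
  let B := b.baseChange (TBMet.ptMap s)
  have hA : ∀ q q' : A.total, dist q q' = dist q.1.1 q'.1.1 := fun q q' =>
    max_eq_left (b := dist q.1.2 q'.1.2) ((TBMet.dist_pt _ _).trans_le dist_nonneg)
  have hB : ∀ q q' : B.total, dist q q' = dist q.1.1 q'.1.1 := fun q q' =>
    max_eq_left (b := dist q.1.2 q'.1.2) ((TBMet.dist_pt _ _).trans_le dist_nonneg)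
  let m : A.total → B.total := fun q =>
    ⟨((e ⟨q.1.1, q.2⟩).1, PUnit.unit), (e ⟨q.1.1, q.2⟩).2⟩
  obtain ⟨k, -, -⟩ := GHObj.exists_isHomLift (a := A) (b := B) rfl rfl (𝟙 TBMet.pt) m
    (fun _ => Subsingleton.elim (α := TBMet.pt.{u}) _ _) (fun q q' => by
      have h₀ : dist (A.projTo rfl q) (A.projTo rfl q') = 0 := TBMet.dist_pt _ _
      exact ((hA q q').trans ((e.isometry.dist_eq ⟨q.1.1, q.2⟩ ⟨q'.1.1, q'.2⟩).symm.trans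
        (hB (m q) (m q')).symm)).trans (max_eq_left (h₀.trans_le dist_nonneg)).symm)
    (fun q _ _ => ⟨⟨((e.symm ⟨q.1.1, q.2⟩).1, PUnit.unit), (e.symm ⟨q.1.1, q.2⟩).2⟩,
      Subtype.ext (Prod.ext (congrArg Subtype.val (e.apply_symm_apply ⟨q.1.1, q.2⟩)) rfl), rfl⟩)
  have h₁ := ghValue_hom φ (a.baseChangeMap (TBMet.ptMap t)) PUnit.unit
  have h₂ := ghValue_hom φ (b.baseChangeMap (TBMet.ptMap s)) PUnit.unit
  have h₃ := ghValue_hom φ k PUnit.unit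
  exact h₁.trans (h₃.symm.trans h₂.symm)

/-- Both fibres occur in one family, over points at most their Gromov–Hausdorff distance apart; on
its base the value is a 1-Lipschitz function. -/
theorem edist_ghValue_le {a b : GHObj.{u}} (t : a.base) (s : b.base) :
    edist (ghValue φ a t) (ghValue φ b s) ≤ edist (a.ghPoint t) (b.ghPoint s) := by
  obtain ⟨c, x, y, hd, hx, hy⟩ := GHObj.exists_family_two (a.FibreAt t) (b.FibreAt s)
  rw [ghValue_eq φ (a := a) (b := c) (t := t) (s := x) hx.symm,
    ghValue_eq φ (a := b) (b := c) (t := s) (s := y) hy.symm]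
  refine ((elMap φ c).edist_le x y).trans ?_
  exact (edist_dist (α := c.base) x y).trans_le
    ((ENNReal.ofReal_le_ofReal hd).trans_eq (edist_dist _ _).symm)

end Values

/-- Universality gives `f` to the Gromov–Hausdorff space. Evaluating `π` on a family with a
prescribed fibre gives a 1-Lipschitz section `g`. Both `g ∘ f` and the identity factor `π` through
itself, so they agree by uniqueness, and `f` is an isometry because its inverse is also 1-Lipschitz.
-/
theorem exists_isometryEquiv_goodModuli_GH :
    Nonempty ((goodModuli GH.{u}) ≃ᵢ ULift.{u + 1} GromovHausdorff.GHSpace) := by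
  have hgood := isGoodModuliSpace_goodModuliMap (𝒳 := GH.{u})
  obtain ⟨f, ⟨hf⟩, -⟩ := hgood ⟨ULift.{u + 1} GromovHausdorff.GHSpace⟩ toGHSpace.{u}
  let π := goodModuliMap GH.{u}
  have hf' : ∀ (a : GHObj.{u}) (t : a.base), LipMap.toFun f (ghValue π a t) = ⟨a.ghPoint t⟩ :=
    fun a t => (congrArg (fun k : LipMap a.base _ => k t)
      ((nonempty_iso_iff_elMap _ _).1 ⟨hf⟩ a)).symm
  choose a t hat using GHObj.exists_ghPoint_eq.{u}
  let g : LipMap (ULift.{u + 1} GromovHausdorff.GHSpace) (goodModuli GH.{u}) :=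
    ⟨fun p => ghValue π (a p.down) (t p.down), fun p q => by
      refine (edist_ghValue_le π _ _).trans ?_
      rw [hat, hat]
      rfl⟩
  have hfg : ∀ p, LipMap.toFun f (g p) = p := fun p =>
    (hf' (a p.down) (t p.down)).trans (congrArg ULift.up (hat p.down))
  have hgf' : ∀ (b : GHObj.{u}) (s : b.base),
      ghValue π b s = g (LipMap.toFun f (ghValue π b s)) := by
    intro b s
    rw [hf']
    exact ghValue_eq π (hat _).symm
  have hgf : ∀ x : goodModuli GH.{u}, g (LipMap.toFun f x) = x := by
    obtain ⟨i, -, hi⟩ := hgood (goodModuli GH.{u}) π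
    have h₁ := hi (𝟙 (goodModuli GH.{u})) ((nonempty_iso_iff_elMap _ _).2 fun _ => rfl)
    have h₂ := hi (LipMap.comp g f) ((nonempty_iso_iff_elMap _ _).2 fun b => by
      exact LipMap.ext (funext (hgf' b)))
    exact fun x => congrArg (fun k : LipMap _ _ => k x) (h₂.trans h₁.symm)
  refine ⟨⟨⟨LipMap.toFun f, g.toFun, hgf, hfg⟩, fun x y => le_antisymm (LipMap.edist_le f x y) ?_⟩⟩
  have := g.edist_le (LipMap.toFun f x) (LipMap.toFun f y)
  rwa [hgf, hgf] at this

theorem isCoarseModuliSpace_GH : IsCoarseModuliSpace (goodModuliMap GH.{u}) where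
  isGood := isGoodModuliSpace_goodModuliMap
  isMet := by
    obtain ⟨e⟩ := exists_isometryEquiv_goodModuli_GH.{u}
    refine ⟨?_, fun x y => ?_, fun x y h => ?_⟩
    -- The Gromov–Hausdorff space lives in the lowest universe, hence is small in every universe.
    · have : Small.{u} (ULift.{u + 1} GromovHausdorff.GHSpace) :=
        small_map (Equiv.ulift.{u + 1} (α := GromovHausdorff.GHSpace))
      exact small_of_injective e.injective
    · rw [← e.isometry.edist_eq]
      exact edist_ne_top _ _
    · rw [← e.isometry.edist_eq] at h
      exact e.injective (edist_eq_zero.1 h)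

theorem completeSpace_goodModuli_GH : CompleteSpace (goodModuli GH.{u}) := by
  obtain ⟨e⟩ := exists_isometryEquiv_goodModuli_GH.{u}
  have : CompleteSpace (ULift.{u + 1} GromovHausdorff.GHSpace) :=
    (isometryEquivULift _).completeSpace_iff.2 inferInstance
  exact (e.isometry.isUniformInducing.completeSpace_congr e.surjective).2 this

end GHStack

theorem mainTheorem10 :
    GHStack.IsSeparated GHStack.GH.{u} ∧
    GHStack.IsCoarseModuliSpace (GHStack.goodModuliMap GHStack.GH.{u}) ∧
    CompleteSpace (GHStack.goodModuli GHStack.GH.{u}) :=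
  ⟨GHStack.isSeparated_GH, GHStack.isCoarseModuliSpace_GH, GHStack.completeSpace_goodModuli_GH⟩
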